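/- Let $\sigma_d$ be the uniform probability measure on the unit sphere of $\mathbb C^d$. A POVM $\mathrm M$ on $\mathbb C^d$ is a $\sigma$-additive map from a $\sigma$-algebra $\mathcal F$ on a set $\Omega$ to the positive operators on $\mathbb C^d$ with $\mathrm M(\Omega)=\mathrm{Id}$; its distinguishability norm is, for Hermitian $\Delta$, $\|\Delta\|_{\mathrm M}=\sup_{A\in\mathcal F}\big[\operatorname{tr}(\Delta\,\mathrm M(A))-\operatorname{tr}(\Delta\,\mathrm M(\Omega\setminus A))\big]$, which for a discrete POVM $\mathrm M=(M_j)_{1\le j\le n}$ equals $\sum_j|\operatorname{tr}(\Delta M_j)|$. The uniform POVM is $\mathrm U_d(A)=d\int_A|\psi\rangle\langle\psi|\,d\sigma_d(\psi)$, and the local uniform POVM on $\mathbb C^{d_1}\otimes\cdots\otimes\mathbb C^{d_k}$ is the tensor product $\mathrm{LU}=\mathrm U_{d_1}\otimes\cdots\otimes\mathrm U_{d_k}$, defined on the product $\sigma$-algebra. For unit vectors $\psi_1,\dots,\psi_n\in\mathbb C^d$ put $P_j=|\psi_j\rangle\langle\psi_j|$ and $S=P_1+\cdots+P_n$; when $S$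 is invertible, $(S^{-1/2}P_jS^{-1/2})_{1\le j\le n}$ is a discrete POVM. Theorem 5.3. There is a universal constant $C>0$ and, for every $0<\varepsilon<1$, a constant $c(\varepsilon)>0$ depending only on $\varepsilon$, such that the following holds. Let $k\ge 1$, $d_1,\dots,d_k\ge 1$ and $$n_i\ \ge\ C\,\varepsilon^{-2}\max(1,|\log\varepsilon|)\,d_i^2\qquad(1\le i\le k).$$ Let $\psi^{(i)}_j$ ($1\le i\le k$, $1\le j\le n_i$) be independent random vectors, $\psi^{(i)}_j$ being uniformly distributed on the unit sphere of $\mathbb C^{d_i}$, and let $\mathrm M_i$ be the family $(S^{-1/2}P_jS^{-1/2})_{1\le j\le n_i}$ built from $\psi^{(i)}_1,\dots,\psi^{(i)}_{n_i}$. Then, except on an event of probability less than $$1-\prod_{i=1}^k\big(1-e^{-c(\varepsilon)d_i}\big)\ \Big(\le\sum_{i=1}^k e^{-c(\varepsilon)d_i}\Big),$$ every $\mathrm M_i$ is a discrete POVM on $\mathbb C^{d_i}$, and for every Hermitian operator $\Delta$ on $\mathbb C^{d_1}\otimes\cdots\otimes\mathbb C^{d_k}$, $$(1-\varepsilon)^k\|\Delta\|_{\mathrm{LU}}\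 \le\ \|\Delta\|_{\mathrm M_1\otimes\cdots\otimes\mathrm M_k}\ \le\ (1+\varepsilon)^k\|\Delta\|_{\mathrm{LU}}.$$ -/

import Mathlib

open MeasureTheory ProbabilityTheory Metric Matrix
open scoped ComplexOrder

noncomputable section

/-! ### POVMs and distinguishability norms -/

/-- A (not necessarily discrete) POVM on the Hilbert space `ℂ^ι`, defined on the `σ`-algebra of the
measurable space `Ω`: a `σ`-additive map from measurable sets to positive operators whose value on
the whole space is the identity. -/
structure POVM (Ω : Type*) [MeasurableSpace Ω] (ι : Type*) [Fintype ι] [DecidableEq ι] where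
  toVectorMeasure : VectorMeasure Ω (Matrix ι ι ℂ)
  posSemidef : ∀ A, MeasurableSet A → (toVectorMeasure A).PosSemidef
  map_univ : toVectorMeasure Set.univ = 1

/-- The distinguishability norm of a POVM, i.e. the total variation of `tr (Δ M(·))`:
the supremum over measurable `A` of `tr (Δ M(A)) - tr (Δ M(Aᶜ))`
(a real number when `Δ` is Hermitian). -/
def POVM.distNorm {Ω : Type*} [MeasurableSpace Ω] {ι : Type*} [Fintype ι] [DecidableEq ι]
    (M : POVM Ω ι) (Δ : Matrix ι ι ℂ) : ℝ :=
  ⨆ A : {A : Set Ω // MeasurableSet A},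
    ((Δ * M.toVectorMeasure A.1).trace - (Δ * M.toVectorMeasure (A.1)ᶜ).trace).re

/-- A finite family of operators is a discrete POVM if its elements are positive and sum to `1`. -/
def IsDiscretePOVM {J ι : Type*} [Fintype J] [Fintype ι] [DecidableEq ι]
    (M : J → Matrix ι ι ℂ) : Prop :=
  (∀ j, (M j).PosSemidef) ∧ ∑ j, M j = 1

/-- The distinguishability norm of a discrete POVM: `∑ j, |tr (Δ M_j)|`. -/
def discreteDistNorm {J ι : Type*} [Fintype J] [Fintype ι]
    (M : J → Matrix ι ι ℂ) (Δ : Matrix ι ι ℂ) : ℝ :=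
  ∑ j, ‖(Δ * M j).trace‖

/-! ### Tensor products

The Hilbert space `ℂ^{d₁} ⊗ ⋯ ⊗ ℂ^{d_k}` is identified, through its product basis, with the space
indexed by multi-indices `(i : Fin k) → Fin (d i)`. -/

/-- The tensor (Kronecker) product `A₁ ⊗ ⋯ ⊗ A_k` of a finite family of matrices. -/
def tensorMatrix {k : ℕ} {d : Fin k → ℕ} (A : ∀ i, Matrix (Fin (d i)) (Fin (d i)) ℂ) :
    Matrix (∀ i, Fin (d i)) (∀ i, Fin (d i)) ℂ :=
  Matrix.of fun a b => ∏ i, A i (a i) (b i)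

/-- The tensor product of discrete POVMs: its elements are all `M₁(j₁) ⊗ ⋯ ⊗ M_k(j_k)`. -/
def tensorFamily {k : ℕ} {d : Fin k → ℕ} {J : Fin k → Type*}
    (M : ∀ i, J i → Matrix (Fin (d i)) (Fin (d i)) ℂ) :
    (∀ i, J i) → Matrix (∀ i, Fin (d i)) (∀ i, Fin (d i)) ℂ :=
  fun j => tensorMatrix fun i => M i (j i)

/-- `N` is the tensor product `M₁ ⊗ ⋯ ⊗ M_k` of general POVMs: it lives on the product
`σ`-algebra and `N (A₁ × ⋯ × A_k) = M₁(A₁) ⊗ ⋯ ⊗ M_k(A_k)`. -/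
def IsTensorPOVM {k : ℕ} {d : Fin k → ℕ} {Ω : Fin k → Type*} [∀ i, MeasurableSpace (Ω i)]
    (M : ∀ i, POVM (Ω i) (Fin (d i))) (N : POVM (∀ i, Ω i) (∀ i, Fin (d i))) : Prop :=
  ∀ A : ∀ i, Set (Ω i), (∀ i, MeasurableSet (A i)) →
    N.toVectorMeasure (Set.univ.pi A) = tensorMatrix fun i => (M i).toVectorMeasure (A i)

/-! ### The POVM with a given operator-valued density -/

open Classical in
/-- The operator-valued measure `A ↦ ∫_A F dμ`; the integral of a matrix is taken entrywise. -/
def densityVectorMeasure {Ω : Type*} [MeasurableSpace Ω] {ι : Type*}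
    (μ : Measure Ω) (F : Ω → Matrix ι ι ℂ) (hF : ∀ a b, Integrable (fun ω => F ω a b) μ) :
    VectorMeasure Ω (Matrix ι ι ℂ) where
  measureOf' A := if MeasurableSet A then Matrix.of fun a b => ∫ ω in A, F ω a b ∂μ else 0
  empty' := by
    ext a b
    simp
  not_measurable' A hA := if_neg hA
  m_iUnion' f hf hd := by
    simp only [hf, MeasurableSet.iUnion hf, if_true]
    refine Pi.hasSum.2 fun a => Pi.hasSum.2 fun b => ?_
    exact hasSum_integral_iUnion hf hd (hF a b).integrableOn

open Classical in
theorem densityVectorMeasure_apply {Ω : Type*} [MeasurableSpace Ω] {ι : Type*}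
    (μ : Measure Ω) (F : Ω → Matrix ι ι ℂ) (hF : ∀ a b, Integrable (fun ω => F ω a b) μ)
    {A : Set Ω} (hA : MeasurableSet A) (a b : ι) :
    densityVectorMeasure μ F hF A a b = ∫ ω in A, F ω a b ∂μ := by
  change (if MeasurableSet A then Matrix.of fun a b => ∫ ω in A, F ω a b ∂μ else 0) a b = _
  simp [hA]

/-- The POVM `A ↦ ∫_A F dμ` attached to a positive operator-valued density `F`
with `∫ F dμ = 1`. -/
def POVM.ofDensity {Ω : Type*} [MeasurableSpace Ω] {ι : Type*} [Fintype ι] [DecidableEq ι]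
    (μ : Measure Ω) (F : Ω → Matrix ι ι ℂ) (hF : ∀ a b, Integrable (fun ω => F ω a b) μ)
    (hpos : ∀ ω, (F ω).PosSemidef)
    (hone : ∀ a b, ∫ ω, F ω a b ∂μ = (1 : Matrix ι ι ℂ) a b) : POVM Ω ι where
  toVectorMeasure := densityVectorMeasure μ F hF
  posSemidef A hA := by
    refine Matrix.PosSemidef.of_dotProduct_mulVec_nonneg ?_ fun x => ?_
    · ext a b
      rw [Matrix.conjTranspose_apply, densityVectorMeasure_apply μ F hF hA,
        densityVectorMeasure_apply μ F hF hA, RCLike.star_def, ← integral_conj]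
      refine integral_congr_ae (Filter.Eventually.of_forall fun ω => ?_)
      have := (hpos ω).isHermitian.apply a b
      simpa using this
    · have key : star x ⬝ᵥ (densityVectorMeasure μ F hF A).mulVec x
          = ∫ ω in A, star x ⬝ᵥ (F ω).mulVec x ∂μ := by
        simp only [dotProduct, Matrix.mulVec]
        rw [integral_finsetSum]
        · refine Finset.sum_congr rfl fun a _ => ?_
          rw [integral_const_mul, integral_finsetSum]
          · congr 1
            refine Finset.sum_congr rfl fun b _ => ?_
            rw [integral_mul_const, densityVectorMeasure_apply μ F hF hA]
          · exact fun b _ => (hF a b).integrableOn.mul_const _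
        · exact fun a _ => (integrable_finsetSum _ fun b _ =>
            (hF a b).integrableOn.mul_const _).const_mul _
      rw [key]
      exact integral_nonneg fun ω => (hpos ω).dotProduct_mulVec_nonneg x
  map_univ := by
    ext a b
    rw [densityVectorMeasure_apply μ F hF MeasurableSet.univ, Measure.restrict_univ, hone]

/-! ### The uniform measure on the unit sphere of `ℂ^d` -/

/-- The unit sphere of `ℂ^d`. -/
abbrev CSphere (d : ℕ) : Type := sphere (0 : EuclideanSpace ℂ (Fin d)) 1

/-- The uniform (Haar) probability measure on the unit sphere of `ℂ^d`, `d ≥ 1`: the normalized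
surface measure. -/
def uniformSphere (d : ℕ) : Measure (CSphere d) :=
  ((volume : Measure (EuclideanSpace ℂ (Fin d))).toSphere Set.univ)⁻¹ •
    (volume : Measure (EuclideanSpace ℂ (Fin d))).toSphere

/-- The rank one operator `|ψ⟩⟨ψ|`. -/
def rankOne {d : ℕ} (ψ : EuclideanSpace ℂ (Fin d)) : Matrix (Fin d) (Fin d) ℂ :=
  vecMulVec ψ.ofLp (star ψ.ofLp)

instance uniformSphere_isFinite (d : ℕ) : IsFiniteMeasure (uniformSphere d) where
  measure_univ_lt_top := by
    rw [uniformSphere, Measure.smul_apply, smul_eq_mul]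
    exact lt_of_le_of_lt (ENNReal.inv_mul_le_one _) ENNReal.one_lt_top

instance uniformSphere_isProbability (d : ℕ) [NeZero d] :
    IsProbabilityMeasure (uniformSphere d) where
  measure_univ := by
    rw [uniformSphere, Measure.smul_apply, smul_eq_mul]
    refine ENNReal.inv_mul_cancel ?_ (measure_ne_top _ _)
    rw [Ne, Measure.measure_univ_eq_zero]
    exact Measure.toSphere_ne_zero _

theorem sphere_coord_le {d : ℕ} (ψ : CSphere d) (a : Fin d) : ‖ψ.1 a‖ ≤ 1 := by
  have h := PiLp.norm_apply_le ψ.1 a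
  rwa [norm_eq_of_mem_sphere ψ] at h

theorem measurable_sphere_coord {d : ℕ} (a : Fin d) : Measurable fun ψ : CSphere d => ψ.1 a := by
  have : Continuous fun ψ : CSphere d => ψ.1 a := by fun_prop
  exact this.measurable

theorem uniformSphere_map {d : ℕ} (L : EuclideanSpace ℂ (Fin d) ≃ₗᵢ[ℝ] EuclideanSpace ℂ (Fin d)) :
    MeasurePreserving (fun ψ : CSphere d => (⟨L ψ.1, by simp⟩ : CSphere d))
      (uniformSphere d) (uniformSphere d) := by
  have hm : Measurable (fun ψ : CSphere d => (⟨L ψ.1, by simp⟩ : CSphere d)) := by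
    have : Continuous (fun ψ : CSphere d => (⟨L ψ.1, by simp⟩ : CSphere d)) := by fun_prop
    exact this.measurable
  refine ⟨hm, ?_⟩
  rw [uniformSphere, Measure.map_smul]
  congr 1
  ext s hs
  rw [Measure.map_apply hm hs, Measure.toSphere_apply' _ (hm hs), Measure.toSphere_apply' _ hs]
  congr 1
  conv_rhs =>
    rw [← (L.measurePreserving).measure_preimage_emb L.toHomeomorph.measurableEmbedding]
  congr 1
  ext x
  simp only [Set.mem_smul, Set.mem_preimage, Set.mem_image]
  constructor
  · rintro ⟨r, hr, _, ⟨ψ, hψ, rfl⟩, h⟩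
    exact ⟨r, hr, _, ⟨_, hψ, rfl⟩, by simp [← h]⟩
  · rintro ⟨r, hr, _, ⟨ψ, hψ, rfl⟩, h⟩
    refine ⟨r, hr, L.symm ψ.1, ⟨⟨L.symm ψ.1, by simp⟩, ?_, rfl⟩, ?_⟩
    · simpa using hψ
    · apply L.injective
      simp [h]

theorem integrable_rankOne {d : ℕ} (a b : Fin d) :
    Integrable (fun ψ : CSphere d => rankOne ψ.1 a b) (uniformSphere d) := by
  refine Integrable.of_bound (C := 1) ?_ (Filter.Eventually.of_forall fun ψ => ?_)
  · exact ((measurable_sphere_coord a).mul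
      (continuous_star.measurable.comp (measurable_sphere_coord b))).aestronglyMeasurable
  · simp only [rankOne, vecMulVec_apply, Pi.star_apply, norm_mul, norm_star]
    exact mul_le_one₀ (sphere_coord_le ψ a) (norm_nonneg _) (sphere_coord_le ψ b)

theorem integral_rankOne_map {d : ℕ}
    (L : EuclideanSpace ℂ (Fin d) ≃ₗᵢ[ℝ] EuclideanSpace ℂ (Fin d)) (a b : Fin d) :
    ∫ ψ, rankOne (L ψ.1) a b ∂(uniformSphere d) = ∫ ψ, rankOne ψ.1 a b ∂(uniformSphere d) := by
  have h := uniformSphere_map L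
  conv_rhs => rw [← h.map_eq]
  rw [integral_map h.measurable.aemeasurable]
  rw [h.map_eq]
  exact (integrable_rankOne a b).aestronglyMeasurable

/-- The barycentre of the pure states is the maximally mixed state: `d ∫ |ψ⟩⟨ψ| = 1`. -/
theorem integral_rankOne {d : ℕ} (a b : Fin d) :
    ∫ ψ, ((d : ℂ) • rankOne ψ.1) a b ∂(uniformSphere d) = (1 : Matrix (Fin d) (Fin d) ℂ) a b := by
  have : NeZero d := ⟨fun h => (h ▸ a).elim0⟩
  simp only [Matrix.smul_apply, smul_eq_mul]
  rw [integral_const_mul]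
  by_cases hab : a = b
  · subst hab
    have hdiag : ∀ c : Fin d, ∫ ψ, rankOne ψ.1 c c ∂(uniformSphere d)
        = ∫ ψ, rankOne ψ.1 a a ∂(uniformSphere d) := by
      intro c
      rw [← integral_rankOne_map (LinearIsometryEquiv.piLpCongrLeft 2 ℝ ℂ (Equiv.swap c a)) c c]
      refine integral_congr_ae (Filter.Eventually.of_forall fun ψ => ?_)
      simp [rankOne, vecMulVec_apply, LinearIsometryEquiv.piLpCongrLeft_apply,
        Equiv.piCongrLeft'_apply]
    have hsum : ∑ c : Fin d, ∫ ψ, rankOne ψ.1 c c ∂(uniformSphere d) = 1 := by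
      rw [← integral_finsetSum _ fun c _ => integrable_rankOne c c]
      have : ∀ ψ : CSphere d, ∑ c : Fin d, rankOne ψ.1 c c = 1 := by
        intro ψ
        have h1 : ‖ψ.1‖ ^ 2 = 1 := by rw [norm_eq_of_mem_sphere ψ]; norm_num
        rw [EuclideanSpace.norm_sq_eq] at h1
        have h2 : ((∑ c, ‖ψ.1 c‖ ^ 2 : ℝ) : ℂ) = 1 := by rw [h1]; simp
        rw [← h2]
        push_cast
        refine Finset.sum_congr rfl fun c _ => ?_
        simp [rankOne, vecMulVec_apply, Complex.mul_conj, Complex.normSq_eq_norm_sq]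
      simp [this]
    rw [Finset.sum_congr rfl fun c _ => hdiag c] at hsum
    simpa using hsum
  · have h := integral_rankOne_map (LinearIsometryEquiv.piLpCongrRight 2 fun i : Fin d =>
      if i = a then LinearIsometryEquiv.neg ℝ (E := ℂ) else LinearIsometryEquiv.refl ℝ ℂ) a b
    have h' : ∫ ψ, rankOne ψ.1 a b ∂(uniformSphere d)
        = -∫ ψ, rankOne ψ.1 a b ∂(uniformSphere d) := by
      rw [← integral_neg, ← h]
      refine integral_congr_ae (Filter.Eventually.of_forall fun ψ => ?_)
      simp [rankOne, vecMulVec_apply, Ne.symm hab]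
    rw [Matrix.one_apply_ne hab, self_eq_neg.1 h', mul_zero]

/-! ### The uniform POVM and the local uniform POVM -/

theorem posSemidef_smul_rankOne {d : ℕ} (ψ : EuclideanSpace ℂ (Fin d)) :
    ((d : ℂ) • rankOne ψ).PosSemidef :=
  (Matrix.posSemidef_vecMulVec_self_star _).smul (by positivity)

/-- The uniform POVM `U_d` on `ℂ^d`: `U_d(A) = d ∫_A |ψ⟩⟨ψ| dσ(ψ)` for `A` in the Borel
`σ`-algebra of the unit sphere. -/
def uniformPOVM (d : ℕ) : POVM (CSphere d) (Fin d) :=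
  POVM.ofDensity (uniformSphere d) (fun ψ => (d : ℂ) • rankOne ψ.1)
    (fun a b => (integrable_rankOne a b).const_mul _)
    (fun ψ => posSemidef_smul_rankOne ψ.1) integral_rankOne

theorem posSemidef_tensor_rankOne {k : ℕ} {d : Fin k → ℕ}
    (ψ : ∀ i, EuclideanSpace ℂ (Fin (d i))) :
    (tensorMatrix fun i => (d i : ℂ) • rankOne (ψ i)).PosSemidef := by
  have : (tensorMatrix fun i => (d i : ℂ) • rankOne (ψ i)) =
      (∏ i, (d i : ℂ)) • vecMulVec (fun a : ∀ i, Fin (d i) => ∏ i, ψ i (a i))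
        (star fun a : ∀ i, Fin (d i) => ∏ i, ψ i (a i)) := by
    ext a b
    simp [tensorMatrix, rankOne, vecMulVec_apply, Finset.prod_mul_distrib]
  rw [this]
  exact (Matrix.posSemidef_vecMulVec_self_star _).smul
    (Finset.prod_nonneg fun i _ => by positivity)

/-- The local uniform POVM `LU = U_{d₁} ⊗ ⋯ ⊗ U_{d_k}` on `ℂ^{d₁} ⊗ ⋯ ⊗ ℂ^{d_k}`, given by
`LU(A) = ∫_A ⨂ᵢ dᵢ |ψᵢ⟩⟨ψᵢ|` on the product of the unit spheres; `localUniformPOVM_isTensor` shows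
that it is the tensor product of the uniform POVMs. -/
def localUniformPOVM {k : ℕ} (d : Fin k → ℕ) :
    POVM (∀ i, CSphere (d i)) (∀ i, Fin (d i)) :=
  POVM.ofDensity (Measure.pi fun i => uniformSphere (d i))
    (fun ψ => tensorMatrix fun i => (d i : ℂ) • rankOne (ψ i).1)
    (fun a b => Integrable.fintype_prod_dep
      (f := fun i (ψ : CSphere (d i)) => ((d i : ℂ) • rankOne ψ.1) (a i) (b i))
      fun i => (integrable_rankOne (a i) (b i)).const_mul _)
    (fun ψ => posSemidef_tensor_rankOne fun i => (ψ i).1)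
    (fun a b => by
      simp only [tensorMatrix, Matrix.of_apply]
      rw [integral_fintype_prod_eq_prod
        (fun i (ψ : CSphere (d i)) => ((d i : ℂ) • rankOne ψ.1) (a i) (b i))]
      simp only [integral_rankOne, Matrix.one_apply, Finset.prod_ite_zero, funext_iff]
      simp)

theorem localUniformPOVM_isTensor {k : ℕ} (d : Fin k → ℕ) :
    IsTensorPOVM (fun i => uniformPOVM (d i)) (localUniformPOVM d) := by
  intro A hA
  ext a b
  simp only [localUniformPOVM, uniformPOVM, POVM.ofDensity, tensorMatrix, Matrix.of_apply]
  rw [densityVectorMeasure_apply _ _ _ (MeasurableSet.univ_pi hA), Measure.restrict_pi_pi]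
  simp only [Matrix.of_apply]
  rw [integral_fintype_prod_eq_prod
    (fun i (ψ : CSphere (d i)) => ((d i : ℂ) • rankOne ψ.1) (a i) (b i))]
  exact Finset.prod_congr rfl fun i _ => (densityVectorMeasure_apply _ _ _ (hA i) _ _).symm

/-! ### The random discrete POVM -/

/-- `S^{-1/2}` for a positive invertible matrix `S` (continuous functional calculus). -/
def invSqrt {d : ℕ} (S : Matrix (Fin d) (Fin d) ℂ) : Matrix (Fin d) (Fin d) ℂ :=
  cfc (fun x : ℝ => (Real.sqrt x)⁻¹) S

/-- The family `(S^{-1/2} Pⱼ S^{-1/2})ⱼ` attached to unit vectors `ψ₁, …, ψₙ` of `ℂ^d`, where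
`Pⱼ = |ψⱼ⟩⟨ψⱼ|` and `S = P₁ + ⋯ + Pₙ`. It is a discrete POVM exactly when `S` is invertible. -/
def normalizedFamily {d n : ℕ} (ψ : Fin n → CSphere d) : Fin n → Matrix (Fin d) (Fin d) ℂ :=
  fun j => invSqrt (∑ l, rankOne (ψ l).1) * rankOne (ψ j).1 * invSqrt (∑ l, rankOne (ψ l).1)

end

/-! For one factor, put `X(ψ) = d⟨ψ|Δ|ψ⟩`, so that the uniform norm of `Δ` is `E|X|`. The key fact
is that `X` is sub-exponential at the scale of its own first moment, with constants free of the
dimension. It comes from a Gaussian computation: under the density proportional to `exp(-‖x‖²)`, the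
expectation of `exp(z⟨x|Δ|x⟩)` is `∏ (1 - zλᵢ)⁻¹`, and in polar coordinates the radius is
independent of the direction, with `r²` of mean `d`. Real `z` and Jensen's inequality in `r` bound
the exponential moments of `X` by the trace and the Frobenius norm of `Δ`. Imaginary `z` bounds the
Frobenius norm by `4 E|X|`. Hence the uniform norm is equivalent to Frobenius norm plus absolute
trace.

Bernstein's inequality then shows that the empirical averages of `|X|` and of `X` are accurate for a
fixed `Δ`. A net of the unit ball of the uniform norm, in a space of real dimension of order `d²`,
and a union bound make this uniform in `Δ`; the dimension explains why `n` of order `d²` suffices,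
and the resolution of the net costs the factor `|log ε|`.

To pass to the normalized family, the averages of `X` are tested on `(d/n)S - 1` itself. This shows
that `(d/n)S` is close to `1` in Frobenius norm, so `S` is invertible and conjugation by `√(n/d)
S^{-1/2}` hardly changes the uniform norm. The norm of the discrete POVM is exactly the empirical
norm of the conjugated operator.

For tensor products, one factor is exchanged at a time: with the other factors fixed, contraction
leaves a Hermitian operator on a single factor, and Tonelli's theorem integrates the local
comparison. Independence of the blocks multiplies the success probabilities. -/

noncomputable section

/-! ### Gaussian integrals and polar coordinates on `ℂ^d` -/

/-- The expectation value `⟨x|Δ|x⟩`, as a real number. -/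
def expect {d : ℕ} (Δ : Matrix (Fin d) (Fin d) ℂ) (x : EuclideanSpace ℂ (Fin d)) : ℝ :=
  (Δ * rankOne x).trace.re

/-- The integral splits into planar Gaussians. The value of `K` hides the ratio of two Haar measures
and is never needed: only its independence of `b` matters, and it is eliminated later by comparison
with `Δ = 0`. -/
theorem exists_gaussian_integral_diagonal (d : ℕ) :
    ∃ K : ℝ, 0 < K ∧ ∀ b : Fin d → ℂ, (∀ i, 0 < (b i).re) →
      ∫ x : EuclideanSpace ℂ (Fin d), Complex.exp (-∑ i, b i * (‖x i‖ : ℂ) ^ 2)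
        = K * ∏ i, (b i)⁻¹ := by
  let e : (Fin d → ℂ) ≃L[ℝ] EuclideanSpace ℂ (Fin d) :=
    (PiLp.continuousLinearEquiv 2 ℝ (fun _ : Fin d => ℂ)).symm
  have hH : ((volume : Measure (Fin d → ℂ)).map e).IsAddHaarMeasure :=
    e.isAddHaarMeasure_map _
  have hc := Measure.isAddLeftInvariant_eq_smul (volume : Measure (EuclideanSpace ℂ (Fin d)))
    ((volume : Measure (Fin d → ℂ)).map e)
  have hc0 := Measure.addHaarScalarFactor_pos_of_isAddHaarMeasure
    (volume : Measure (EuclideanSpace ℂ (Fin d))) ((volume : Measure (Fin d → ℂ)).map e)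
  set c := Measure.addHaarScalarFactor
    (volume : Measure (EuclideanSpace ℂ (Fin d))) ((volume : Measure (Fin d → ℂ)).map e)
  refine ⟨c * Real.pi ^ d, mul_pos (NNReal.coe_pos.2 hc0) (by positivity), ?_⟩
  intro b hb
  have he : MeasurableEmbedding e := e.toHomeomorph.measurableEmbedding
  rw [hc, integral_smul_nnreal_measure, he.integral_map]
  have h1 : ∀ x : Fin d → ℂ, Complex.exp (-∑ i, b i * (‖e x i‖ : ℂ) ^ 2)
      = ∏ i, Complex.exp (-b i * (‖x i‖ : ℂ) ^ 2) := by
    intro x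
    rw [← Complex.exp_sum, ← Finset.sum_neg_distrib]
    simp only [neg_mul]
    rfl
  simp_rw [h1]
  rw [volume_pi, integral_fintype_prod_eq_prod (fun i (y : ℂ) => Complex.exp (-b i * (‖y‖ : ℂ) ^ 2))]
  have h2 : ∀ i, ∫ y : ℂ, Complex.exp (-b i * (‖y‖ : ℂ) ^ 2) = Real.pi * (b i)⁻¹ := by
    intro i
    rw [GaussianFourier.integral_cexp_neg_mul_sq_norm (hb i)]
    simp [Complex.finrank_real_complex, div_eq_mul_inv]
  simp_rw [h2]
  rw [Finset.prod_mul_distrib]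
  simp [mul_assoc, NNReal.smul_def]

theorem trace_mul_rankOne {d : ℕ} (Δ : Matrix (Fin d) (Fin d) ℂ) (x : EuclideanSpace ℂ (Fin d)) :
    (Δ * rankOne x).trace = star x.ofLp ⬝ᵥ (Δ *ᵥ x.ofLp) := by
  rw [rankOne, Matrix.mul_vecMulVec, Matrix.trace_vecMulVec, dotProduct_comm]

theorem trace_mul_rankOne_eq_expect {d : ℕ} {Δ : Matrix (Fin d) (Fin d) ℂ} (hΔ : Δ.IsHermitian)
    (x : EuclideanSpace ℂ (Fin d)) : (Δ * rankOne x).trace = expect Δ x := by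
  rw [expect]
  refine (Complex.conj_eq_iff_re.1 ?_).symm
  have h : (rankOne x).IsHermitian := (Matrix.posSemidef_vecMulVec_self_star _).isHermitian
  rw [← RCLike.star_def, ← Matrix.trace_conjTranspose, Matrix.conjTranspose_mul, hΔ.eq, h.eq,
    Matrix.trace_mul_comm]

theorem expect_smul {d : ℕ} (Δ : Matrix (Fin d) (Fin d) ℂ) (x : EuclideanSpace ℂ (Fin d))
    (r : ℝ) : expect Δ (r • x) = r ^ 2 * expect Δ x := by
  have : rankOne (r • x) = (r ^ 2) • rankOne x := by
    ext a b
    simp [rankOne, vecMulVec_apply]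
    ring
  rw [expect, this, Matrix.mul_smul, Matrix.trace_smul, Complex.smul_re, smul_eq_mul, expect]

theorem expect_eq_sum_eigenvalues {d : ℕ} {Δ : Matrix (Fin d) (Fin d) ℂ} (hΔ : Δ.IsHermitian)
    (x : EuclideanSpace ℂ (Fin d)) :
    expect Δ x = ∑ i, hΔ.eigenvalues i * ‖hΔ.eigenvectorBasis.repr x i‖ ^ 2 := by
  have hx : Δ *ᵥ x.ofLp = ∑ i, hΔ.eigenvectorBasis.repr x i •
      (hΔ.eigenvalues i • (hΔ.eigenvectorBasis i).ofLp) := by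
    conv_lhs => rw [← hΔ.eigenvectorBasis.sum_repr x]
    rw [WithLp.ofLp_sum, Matrix.mulVec_sum]
    refine Finset.sum_congr rfl fun i _ => ?_
    rw [WithLp.ofLp_smul, Matrix.mulVec_smul, hΔ.mulVec_eigenvectorBasis]
  rw [expect, trace_mul_rankOne, hx, dotProduct_sum, Complex.re_sum]
  refine Finset.sum_congr rfl fun i _ => ?_
  have h1 : star x.ofLp ⬝ᵥ (hΔ.eigenvectorBasis i).ofLp
      = star (hΔ.eigenvectorBasis.repr x i) := by
    rw [hΔ.eigenvectorBasis.repr_apply_apply, EuclideanSpace.inner_eq_star_dotProduct,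
      Matrix.star_dotProduct, dotProduct_comm]
  rw [dotProduct_smul, dotProduct_smul, h1, Complex.real_smul, smul_eq_mul]
  have h2 : ∀ w : ℂ, w * star w = ((‖w‖ ^ 2 : ℝ) : ℂ) := fun w => by
    rw [RCLike.star_def, Complex.mul_conj, Complex.normSq_eq_norm_sq]
  rw [mul_left_comm, h2, ← Complex.ofReal_mul, Complex.ofReal_re]

/-- Passing to eigenbasis coordinates is an isometry, so it preserves both the volume and the
Gaussian weight and reduces the integral to the diagonal case. -/
theorem exists_gaussian_integral_expect (d : ℕ) :
    ∃ K : ℝ, 0 < K ∧ ∀ (Δ : Matrix (Fin d) (Fin d) ℂ) (hΔ : Δ.IsHermitian) (z : ℂ),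
      (∀ i, (z * hΔ.eigenvalues i).re < 1) →
      ∫ x : EuclideanSpace ℂ (Fin d), (Real.exp (-‖x‖ ^ 2) : ℂ) * Complex.exp (z * expect Δ x)
        = K * ∏ i, (1 - z * hΔ.eigenvalues i)⁻¹ := by
  obtain ⟨K, hK, h⟩ := exists_gaussian_integral_diagonal d
  refine ⟨K, hK, fun Δ hΔ z hz => ?_⟩
  let L : EuclideanSpace ℂ (Fin d) ≃ₗᵢ[ℝ] EuclideanSpace ℂ (Fin d) :=
    { hΔ.eigenvectorBasis.repr.toLinearEquiv.restrictScalars ℝ with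
      norm_map' := hΔ.eigenvectorBasis.repr.norm_map }
  rw [← h (fun i => 1 - z * hΔ.eigenvalues i) (fun i => by simpa using hz i)]
  conv_rhs => rw [← L.measurePreserving.integral_comp L.toHomeomorph.measurableEmbedding]
  refine integral_congr_ae (Filter.Eventually.of_forall fun x => ?_)
  have hL : ∀ i, L x i = hΔ.eigenvectorBasis.repr x i := fun i => rfl
  have hn : ‖x‖ ^ 2 = ∑ i, ‖L x i‖ ^ 2 := by
    rw [← L.norm_map, EuclideanSpace.norm_sq_eq]
  dsimp only
  rw [Complex.ofReal_exp, ← Complex.exp_add, hn, expect_eq_sum_eigenvalues hΔ]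
  simp only [← hL]
  congr 1
  push_cast
  rw [Finset.mul_sum, ← Finset.sum_neg_distrib, ← Finset.sum_neg_distrib, ← Finset.sum_add_distrib]
  exact Finset.sum_congr rfl fun i _ => by ring

theorem integral_eq_integral_polar {d : ℕ} [NeZero d] (f : EuclideanSpace ℂ (Fin d) → ℂ) :
    ∫ x, f x = ∫ p, f (p.2.1 • p.1.1)
      ∂((volume : Measure (EuclideanSpace ℂ (Fin d))).toSphere.prod
        (Measure.volumeIoiPow (2 * d - 1))) := by
  have hd : Module.finrank ℝ (EuclideanSpace ℂ (Fin d)) = 2 * d := by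
    rw [← Module.finrank_mul_finrank ℝ ℂ, Complex.finrank_real_complex, finrank_euclideanSpace_fin]
  have h := (volume : Measure (EuclideanSpace ℂ (Fin d))).measurePreserving_homeomorphUnitSphereProd
  rw [hd] at h
  rw [← h.integral_comp (Homeomorph.measurableEmbedding _)]
  have h0 : ∫ x, f x = ∫ x : ({(0)}ᶜ : Set (EuclideanSpace ℂ (Fin d))), f x.1
      ∂((volume : Measure (EuclideanSpace ℂ (Fin d))).comap (↑)) := by
    rw [integral_subtype_comap (measurableSet_singleton _).compl f, restrict_compl_singleton]
  rw [h0]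
  refine integral_congr_ae (Filter.Eventually.of_forall fun x => ?_)
  dsimp only
  congr 1
  simp [smul_smul, mul_inv_cancel₀ (norm_ne_zero_iff.2 x.2)]

theorem integral_volumeIoiPow (n : ℕ) (f : ℝ → ℝ) :
    ∫ r : Set.Ioi (0 : ℝ), f r ∂(Measure.volumeIoiPow n) = ∫ r in Set.Ioi (0 : ℝ), r ^ n * f r := by
  simp only [Measure.volumeIoiPow, ENNReal.ofReal]
  rw [integral_withDensity_eq_integral_smul,
    integral_subtype_comap measurableSet_Ioi fun a => Real.toNNReal (a ^ n) • f a,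
    setIntegral_congr_fun measurableSet_Ioi fun x hx => ?_]
  · rw [NNReal.smul_def, Real.coe_toNNReal _ (pow_nonneg (le_of_lt hx) _), smul_eq_mul]
  · exact (measurable_subtype_coe.pow_const _).real_toNNReal

theorem integral_pow_mul_exp_neg_sq (n : ℕ) :
    ∫ r in Set.Ioi (0 : ℝ), r ^ n * Real.exp (-r ^ 2) = 1 / 2 * Real.Gamma ((n + 1) / 2) := by
  rw [← integral_rpow_mul_exp_neg_rpow (p := 2) (q := n) (by norm_num)
    (by have : (0 : ℝ) ≤ n := n.cast_nonneg
        linarith)]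
  refine setIntegral_congr_fun measurableSet_Ioi fun x hx => ?_
  simp

theorem integral_radial {d : ℕ} [NeZero d] :
    ∫ r : Set.Ioi (0 : ℝ), Real.exp (-r.1 ^ 2) ∂(Measure.volumeIoiPow (2 * d - 1))
      = 1 / 2 * Real.Gamma d := by
  have hd : 1 ≤ 2 * d := by have := NeZero.pos d; omega
  rw [integral_volumeIoiPow (2 * d - 1) fun r => Real.exp (-r ^ 2), integral_pow_mul_exp_neg_sq]
  congr 2
  push_cast [hd]
  ring

/-- Relative to `integral_radial`, the variable `r²` has mean `d`. This is the origin of the factor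
`d` in `scaledExpect`. -/
theorem integral_radial_sq {d : ℕ} [NeZero d] :
    ∫ r : Set.Ioi (0 : ℝ), r.1 ^ 2 * Real.exp (-r.1 ^ 2) ∂(Measure.volumeIoiPow (2 * d - 1))
      = d * (1 / 2 * Real.Gamma d) := by
  have hd : 1 ≤ 2 * d := by have := NeZero.pos d; omega
  rw [integral_volumeIoiPow (2 * d - 1) fun r => r ^ 2 * Real.exp (-r ^ 2)]
  simp only [← mul_assoc, ← pow_add]
  rw [integral_pow_mul_exp_neg_sq, show (((2 * d - 1 + 2 : ℕ) : ℝ) + 1) / 2 = d + 1 by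
    push_cast [hd]; ring, Real.Gamma_add_one (by simp [NeZero.ne d])]
  ring

theorem radial_pos (d : ℕ) [NeZero d] : 0 < 1 / 2 * Real.Gamma d := by
  have : (0 : ℝ) < d := Nat.cast_pos.2 (NeZero.pos d)
  have := Real.Gamma_pos_of_pos this
  positivity

/-- The Bochner integral of a non-integrable function is `0` by convention, so a nonzero value
already forces integrability. The same device is used below. -/
theorem integrable_radial {d : ℕ} [NeZero d] :
    Integrable (fun r : Set.Ioi (0 : ℝ) => Real.exp (-r.1 ^ 2))
      (Measure.volumeIoiPow (2 * d - 1)) :=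
  not_imp_comm.1 integral_undef (by rw [integral_radial]; exact (radial_pos d).ne')

theorem integrable_radial_sq {d : ℕ} [NeZero d] :
    Integrable (fun r : Set.Ioi (0 : ℝ) => r.1 ^ 2 * Real.exp (-r.1 ^ 2))
      (Measure.volumeIoiPow (2 * d - 1)) :=
  not_imp_comm.1 integral_undef (by
    rw [integral_radial_sq]
    exact mul_ne_zero (NeZero.ne _) (radial_pos d).ne')

theorem continuous_expect {d : ℕ} (Δ : Matrix (Fin d) (Fin d) ℂ) :
    Continuous (expect Δ) := by
  have : expect Δ = fun x => (∑ a, ∑ b, Δ a b * (x b * star (x a))).re := by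
    ext x
    simp [expect, Matrix.trace, Matrix.mul_apply, rankOne, vecMulVec_apply]
  rw [this]
  fun_prop

/-- Polar decomposition of the complex Gaussian measure, tested on `exp (z ⟨x|Δ|x⟩)`. -/
theorem integral_polar_cexp_expect {d : ℕ} [NeZero d] {Δ : Matrix (Fin d) (Fin d) ℂ}
    (hΔ : Δ.IsHermitian) (z : ℂ) (hz : ∀ i, (z * hΔ.eigenvalues i).re < 1) :
    ∫ p : CSphere d × Set.Ioi (0 : ℝ),
        (Real.exp (-p.2.1 ^ 2) : ℂ) * Complex.exp (z * (p.2.1 ^ 2 * expect Δ p.1.1 : ℝ))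
      ∂((uniformSphere d).prod (Measure.volumeIoiPow (2 * d - 1)))
      = (1 / 2 * Real.Gamma d : ℝ) * ∏ i, (1 - z * hΔ.eigenvalues i)⁻¹ := by
  obtain ⟨K, hK, h⟩ := exists_gaussian_integral_expect d
  set c := ((volume : Measure (EuclideanSpace ℂ (Fin d))).toSphere Set.univ)⁻¹ with hc
  have key : ∀ {Δ : Matrix (Fin d) (Fin d) ℂ} (hΔ : Δ.IsHermitian) (z : ℂ),
      (∀ i, (z * hΔ.eigenvalues i).re < 1) →
      ∫ p : CSphere d × Set.Ioi (0 : ℝ),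
        (Real.exp (-p.2.1 ^ 2) : ℂ) * Complex.exp (z * (p.2.1 ^ 2 * expect Δ p.1.1 : ℝ))
      ∂((uniformSphere d).prod (Measure.volumeIoiPow (2 * d - 1)))
      = (c.toReal * K : ℝ) * ∏ i, (1 - z * hΔ.eigenvalues i)⁻¹ := by
    intro Δ hΔ z hz
    rw [uniformSphere, Measure.prod_smul_left, integral_smul_measure, Complex.ofReal_mul, mul_assoc,
      ← h Δ hΔ z hz, integral_eq_integral_polar, ← hc, Complex.real_smul]
    congr 1
    refine integral_congr_ae (Filter.Eventually.of_forall fun p => ?_)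
    have hp : (0 : ℝ) < p.2.1 := p.2.2
    simp [expect_smul, norm_smul, abs_of_pos hp]
  -- The case `Δ = 0`, `z = 0` identifies the unknown constant as the radial mass.
  have h1 := key (Δ := 0) Matrix.isHermitian_zero 0 (by simp)
  have h2 : ∫ p : CSphere d × Set.Ioi (0 : ℝ), (Real.exp (-p.2.1 ^ 2) : ℂ)
      ∂((uniformSphere d).prod (Measure.volumeIoiPow (2 * d - 1)))
      = (1 / 2 * Real.Gamma d : ℝ) := by
    rw [integral_fun_snd (fun r : Set.Ioi (0 : ℝ) => (Real.exp (-r.1 ^ 2) : ℂ)),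
      integral_complex_ofReal, integral_radial]
    simp
  simp only [zero_mul, Complex.exp_zero, mul_one, sub_zero, inv_one, Finset.prod_const_one] at h1
  rw [key hΔ z hz, ← h1, h2]

theorem integrable_polar_cexp_expect {d : ℕ} [NeZero d] {Δ : Matrix (Fin d) (Fin d) ℂ}
    (hΔ : Δ.IsHermitian) (z : ℂ) (hz : ∀ i, (z * hΔ.eigenvalues i).re < 1) :
    Integrable (fun p : CSphere d × Set.Ioi (0 : ℝ) =>
        (Real.exp (-p.2.1 ^ 2) : ℂ) * Complex.exp (z * (p.2.1 ^ 2 * expect Δ p.1.1 : ℝ)))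
      ((uniformSphere d).prod (Measure.volumeIoiPow (2 * d - 1))) := by
  refine not_imp_comm.1 integral_undef ?_
  rw [integral_polar_cexp_expect hΔ z hz]
  refine mul_ne_zero (Complex.ofReal_ne_zero.2 (radial_pos d).ne')
    (Finset.prod_ne_zero_iff.2 fun i _ => inv_ne_zero fun h => ?_)
  have := congrArg Complex.re h
  have h3 := hz i
  rw [Complex.sub_re, Complex.one_re, Complex.zero_re] at this
  linarith

/-- The random variable `d ⟨ψ|Δ|ψ⟩` on the unit sphere. -/
def scaledExpect {d : ℕ} (Δ : Matrix (Fin d) (Fin d) ℂ) (ψ : CSphere d) : ℝ := d * expect Δ ψ.1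

/-- The distinguishability norm of the uniform POVM: `d ∫ |⟨ψ|Δ|ψ⟩| dσ(ψ)`. -/
def uniformNorm {d : ℕ} (Δ : Matrix (Fin d) (Fin d) ℂ) : ℝ :=
  ∫ ψ, |scaledExpect Δ ψ| ∂(uniformSphere d)

theorem continuous_scaledExpect {d : ℕ} (Δ : Matrix (Fin d) (Fin d) ℂ) :
    Continuous (scaledExpect Δ) := by
  have := continuous_expect Δ
  unfold scaledExpect
  fun_prop

theorem _root_.Continuous.integrable_uniformSphere {d : ℕ} {E : Type*} [NormedAddCommGroup E]
    {f : CSphere d → E} (hf : Continuous f) :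
    Integrable f (uniformSphere d) := by
  rw [← integrableOn_univ]
  exact hf.continuousOn.integrableOn_compact isCompact_univ

/-- Jensen's inequality in the radial variable: replacing `r²` by its mean `d` can only decrease the
exponential moment known from the Gaussian integral. -/
theorem integral_exp_scaledExpect_le {d : ℕ} [NeZero d] {Δ : Matrix (Fin d) (Fin d) ℂ}
    (hΔ : Δ.IsHermitian) (t : ℝ) (ht : ∀ i, t * hΔ.eigenvalues i < 1) :
    ∫ ψ, Real.exp (t * scaledExpect Δ ψ) ∂(uniformSphere d)
      ≤ ∏ i, (1 - t * hΔ.eigenvalues i)⁻¹ := by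
  have ht' : ∀ i, ((t : ℂ) * hΔ.eigenvalues i).re < 1 := fun i => by
    rw [← Complex.ofReal_mul, Complex.ofReal_re]; exact ht i
  set ρ := Measure.volumeIoiPow (2 * d - 1)
  set g : CSphere d × Set.Ioi (0 : ℝ) → ℝ := fun p =>
    Real.exp (-p.2.1 ^ 2) * Real.exp (t * (p.2.1 ^ 2 * expect Δ p.1.1)) with hg
  have hgc : (fun p => (g p : ℂ)) = fun p : CSphere d × Set.Ioi (0 : ℝ) =>
      (Real.exp (-p.2.1 ^ 2) : ℂ) * Complex.exp (t * (p.2.1 ^ 2 * expect Δ p.1.1 : ℝ)) := by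
    ext p
    simp [hg]
  have hint : Integrable g ((uniformSphere d).prod ρ) := by
    have h := integrable_polar_cexp_expect hΔ t ht'
    rw [← hgc] at h
    simpa using h.re
  have hval : ∫ p, g p ∂((uniformSphere d).prod ρ)
      = (1 / 2 * Real.Gamma d) * ∏ i, (1 - t * hΔ.eigenvalues i)⁻¹ := by
    have h := integral_polar_cexp_expect hΔ t ht'
    rw [← hgc, integral_complex_ofReal] at h
    exact_mod_cast h
  rw [integral_prod _ hint] at hval
  refine le_of_mul_le_mul_left ?_ (radial_pos d)
  rw [← hval, ← integral_const_mul]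
  refine integral_mono_ae ?_ hint.integral_prod_left ?_
  · refine Continuous.integrable_uniformSphere ?_
    have := continuous_scaledExpect Δ
    fun_prop
  filter_upwards [hint.prod_right_ae] with ψ hψ
  set x := t * scaledExpect Δ ψ with hx
  set q := t * expect Δ ψ.1 with hq
  have hxq : x = d * q := by rw [hx, hq, scaledExpect]; ring
  -- The tangent line to `exp` at `x`. Its linear part integrates to zero against the radial weight,
  -- because `x = d * q` and `r²` has mean `d`.
  have hlow : ∀ r : Set.Ioi (0 : ℝ), Real.exp x * (1 - x) * Real.exp (-r.1 ^ 2)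
      + Real.exp x * q * (r.1 ^ 2 * Real.exp (-r.1 ^ 2)) ≤ g (ψ, r) := by
    intro r
    have h1 : Real.exp x * (r.1 ^ 2 * q - x + 1) ≤ Real.exp (t * (r.1 ^ 2 * expect Δ ψ.1)) := by
      have h2 : t * (r.1 ^ 2 * expect Δ ψ.1) = x + (r.1 ^ 2 * q - x) := by rw [hq]; ring
      rw [h2, Real.exp_add]
      exact mul_le_mul_of_nonneg_left (Real.add_one_le_exp _) (Real.exp_pos _).le
    have h3 := mul_le_mul_of_nonneg_left h1 (Real.exp_pos (-r.1 ^ 2)).le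
    rw [hg]
    refine le_trans (le_of_eq ?_) h3
    ring
  have hi1 := (integrable_radial (d := d)).const_mul (Real.exp x * (1 - x))
  have hi2 := (integrable_radial_sq (d := d)).const_mul (Real.exp x * q)
  have := integral_mono (hi1.add hi2) hψ hlow
  rw [integral_add' hi1 hi2, integral_const_mul, integral_const_mul, integral_radial,
    integral_radial_sq] at this
  refine le_trans (le_of_eq ?_) this
  rw [hxq]
  ring

/-- At `z = it` the Gaussian formula is a characteristic function. Since `1 - cos y ≤ |y|`, its
distance from `1` is controlled by a first absolute moment, whose radial factor is again `d`. -/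
theorem one_sub_re_prod_le_uniformNorm {d : ℕ} [NeZero d] {Δ : Matrix (Fin d) (Fin d) ℂ}
    (hΔ : Δ.IsHermitian) {t : ℝ} (ht : 0 ≤ t) :
    1 - (∏ i, (1 - (t * Complex.I) * hΔ.eigenvalues i)⁻¹).re ≤ t * uniformNorm Δ := by
  have ht' : ∀ i, ((t * Complex.I : ℂ) * hΔ.eigenvalues i).re < 1 := fun i => by simp
  set ρ := Measure.volumeIoiPow (2 * d - 1)
  have hint := (integrable_polar_cexp_expect hΔ _ ht')
  have hval := integral_polar_cexp_expect hΔ _ ht'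
  have hre := congrArg Complex.re hval
  rw [← RCLike.re_eq_complex_re, ← integral_re hint, RCLike.re_eq_complex_re, Complex.re_ofReal_mul] at hre
  have hint' := hint.re
  have hcos : ∀ p : CSphere d × Set.Ioi (0 : ℝ), Complex.re ((Real.exp (-p.2.1 ^ 2) : ℂ) *
      Complex.exp ((t * Complex.I) * (p.2.1 ^ 2 * expect Δ p.1.1 : ℝ)))
      = Real.exp (-p.2.1 ^ 2) * Real.cos (t * (p.2.1 ^ 2 * expect Δ p.1.1)) := by
    intro p
    rw [Complex.re_ofReal_mul, mul_right_comm, ← Complex.ofReal_mul,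
      Complex.exp_ofReal_mul_I_re]
  simp only [RCLike.re_eq_complex_re] at hint'
  simp_rw [hcos] at hre hint'
  have hone : Integrable (fun p : CSphere d × Set.Ioi (0 : ℝ) => Real.exp (-p.2.1 ^ 2))
      ((uniformSphere d).prod ρ) := (integrable_radial (d := d)).comp_snd (uniformSphere d)
  have honev : ∫ p : CSphere d × Set.Ioi (0 : ℝ), Real.exp (-p.2.1 ^ 2)
      ∂((uniformSphere d).prod ρ) = 1 / 2 * Real.Gamma d := by
    rw [integral_fun_snd (fun r : Set.Ioi (0 : ℝ) => Real.exp (-r.1 ^ 2)), integral_radial]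
    simp
  have hq : Integrable (fun ψ : CSphere d => |expect Δ ψ.1|) (uniformSphere d) := by
    refine Continuous.integrable_uniformSphere ?_
    have := continuous_expect Δ
    fun_prop
  have hm : Integrable (fun p : CSphere d × Set.Ioi (0 : ℝ) =>
      |expect Δ p.1.1| * (p.2.1 ^ 2 * Real.exp (-p.2.1 ^ 2))) ((uniformSphere d).prod ρ) :=
    hq.mul_prod integrable_radial_sq
  have hmv : ∫ p : CSphere d × Set.Ioi (0 : ℝ),
      |expect Δ p.1.1| * (p.2.1 ^ 2 * Real.exp (-p.2.1 ^ 2)) ∂((uniformSphere d).prod ρ)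
      = (1 / 2 * Real.Gamma d) * uniformNorm Δ := by
    rw [integral_prod_mul (fun ψ : CSphere d => |expect Δ ψ.1|)
      (fun r : Set.Ioi (0 : ℝ) => r.1 ^ 2 * Real.exp (-r.1 ^ 2)), integral_radial_sq, uniformNorm]
    simp only [scaledExpect, abs_mul, Nat.abs_cast, integral_const_mul]
    ring
  have hle := integral_mono (hone.sub hint') (hm.const_mul t) fun p => ?_
  · rw [integral_sub' hone hint', honev, hre, integral_const_mul, hmv] at hle
    refine le_of_mul_le_mul_left ?_ (radial_pos d)
    refine le_trans (le_of_eq ?_) (hle.trans (le_of_eq ?_))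
    · ring
    · ring
  · have h1 : 1 - Real.cos (t * (p.2.1 ^ 2 * expect Δ p.1.1))
        ≤ |t * (p.2.1 ^ 2 * expect Δ p.1.1)| := by
      have h2 : ∀ y : ℝ, 1 - Real.cos y ≤ |y| := by
        intro y
        have h3 := Real.one_sub_sq_div_two_le_cos (x := y)
        have h4 := Real.neg_one_le_cos y
        rcases le_total |y| 2 with h | h
        · nlinarith [abs_nonneg y, sq_abs y]
        · linarith
      exact h2 _
    rw [abs_mul, abs_mul, abs_of_nonneg ht, abs_of_nonneg (sq_nonneg p.2.1)] at h1
    have h5 := mul_le_mul_of_nonneg_left h1 (Real.exp_pos (-p.2.1 ^ 2)).le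
    refine le_trans (le_of_eq ?_) (h5.trans (le_of_eq ?_))
    · simp only [Pi.sub_apply]
      ring
    · ring

/-! ### Comparison of the uniform norm with the Frobenius norm -/

theorem one_add_sum_le_prod_one_add {ι : Type*} (s : Finset ι) {f : ι → ℝ} (hf : ∀ i, 0 ≤ f i) :
    1 + ∑ i ∈ s, f i ≤ ∏ i ∈ s, (1 + f i) := by
  classical
  induction s using Finset.induction_on with
  | empty => simp
  | insert a s ha ih =>
    rw [Finset.sum_insert ha, Finset.prod_insert ha]
    nlinarith [mul_nonneg (hf a) (Finset.sum_nonneg fun i (_ : i ∈ s) => hf i),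
      mul_le_mul_of_nonneg_left ih (hf a)]

section Frobenius

open scoped Matrix.Norms.Frobenius

theorem frobenius_norm_sq_eq_sum {d : ℕ} (A : Matrix (Fin d) (Fin d) ℂ) :
    ‖A‖ ^ 2 = ∑ a, ∑ b, ‖A a b‖ ^ 2 := by
  rw [Matrix.frobenius_norm_def, ← Real.rpow_natCast, ← Real.rpow_mul (by positivity)]
  simp

theorem frobenius_norm_sq_eq_trace {d : ℕ} (A : Matrix (Fin d) (Fin d) ℂ) :
    ‖A‖ ^ 2 = (A * Aᴴ).trace.re := by
  rw [frobenius_norm_sq_eq_sum, Matrix.trace, Complex.re_sum]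
  refine Finset.sum_congr rfl fun a _ => ?_
  rw [Matrix.diag_apply, Matrix.mul_apply, Complex.re_sum]
  refine Finset.sum_congr rfl fun b _ => ?_
  rw [Matrix.conjTranspose_apply, RCLike.star_def, Complex.mul_conj, Complex.normSq_eq_norm_sq,
    Complex.ofReal_re]

theorem norm_trace_mul_le {d : ℕ} (A B : Matrix (Fin d) (Fin d) ℂ) :
    ‖(A * B).trace‖ ≤ ‖A‖ * ‖B‖ := by
  have h1 : ‖(A * B).trace‖ ≤ ∑ p : Fin d × Fin d, ‖A p.1 p.2‖ * ‖B p.2 p.1‖ := by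
    rw [Fintype.sum_prod_type, Matrix.trace]
    refine (norm_sum_le _ _).trans (Finset.sum_le_sum fun a _ => ?_)
    rw [Matrix.diag_apply, Matrix.mul_apply]
    exact (norm_sum_le _ _).trans (Finset.sum_le_sum fun b _ => (norm_mul _ _).le)
  have h2 := Finset.sum_mul_sq_le_sq_mul_sq Finset.univ (fun p : Fin d × Fin d => ‖A p.1 p.2‖)
    (fun p => ‖B p.2 p.1‖)
  have hA : ∑ p : Fin d × Fin d, ‖A p.1 p.2‖ ^ 2 = ‖A‖ ^ 2 := by
    rw [Fintype.sum_prod_type, frobenius_norm_sq_eq_sum]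
  have hB : ∑ p : Fin d × Fin d, ‖B p.2 p.1‖ ^ 2 = ‖B‖ ^ 2 := by
    rw [Fintype.sum_prod_type, frobenius_norm_sq_eq_sum, Finset.sum_comm]
  rw [hA, hB, ← mul_pow] at h2
  exact h1.trans (le_of_sq_le_sq h2 (by positivity))

theorem frobenius_norm_sq_cfc {d : ℕ} {A : Matrix (Fin d) (Fin d) ℂ} (hA : A.IsHermitian)
    (f : ℝ → ℝ) : ‖cfc f A‖ ^ 2 = ∑ i, f (hA.eigenvalues i) ^ 2 := by
  have hs : (cfc f A)ᴴ = cfc f A := (cfc_predicate f A : IsSelfAdjoint _)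
  rw [frobenius_norm_sq_eq_trace, hs, hA.cfc_eq, Matrix.IsHermitian.cfc, ← map_mul,
    Unitary.conjStarAlgAut_apply, Matrix.trace_mul_cycle,
    Unitary.coe_star_mul_self, one_mul, Matrix.diagonal_mul_diagonal, Matrix.trace_diagonal,
    Complex.re_sum]
  refine Finset.sum_congr rfl fun i _ => ?_
  simp [sq]

theorem frobenius_norm_sq_eq_sum_eigenvalues {d : ℕ} {A : Matrix (Fin d) (Fin d) ℂ}
    (hA : A.IsHermitian) : ‖A‖ ^ 2 = ∑ i, hA.eigenvalues i ^ 2 := by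
  rw [← frobenius_norm_sq_cfc hA fun x => x, cfc_id' ℝ A]

theorem abs_eigenvalue_le_frobenius {d : ℕ} {A : Matrix (Fin d) (Fin d) ℂ}
    (hA : A.IsHermitian) (i : Fin d) : |hA.eigenvalues i| ≤ ‖A‖ := by
  refine abs_le_of_sq_le_sq ?_ (norm_nonneg _)
  rw [frobenius_norm_sq_eq_sum_eigenvalues hA]
  exact Finset.single_le_sum (f := fun i => hA.eigenvalues i ^ 2) (fun _ _ => sq_nonneg _)
    (Finset.mem_univ i)

theorem integral_scaledExpect {d : ℕ} (Δ : Matrix (Fin d) (Fin d) ℂ) :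
    ∫ ψ, scaledExpect Δ ψ ∂(uniformSphere d) = Δ.trace.re := by
  have h1 : ∀ ψ : CSphere d, scaledExpect Δ ψ
      = (∑ a, ∑ b, Δ a b * ((d : ℂ) • rankOne ψ.1) b a).re := by
    intro ψ
    rw [scaledExpect, expect, ← Complex.re_ofReal_mul, Matrix.trace, Finset.mul_sum]
    congr 1
    refine Finset.sum_congr rfl fun a _ => ?_
    rw [Matrix.diag_apply, Matrix.mul_apply, Finset.mul_sum]
    refine Finset.sum_congr rfl fun b _ => ?_
    rw [Matrix.smul_apply, smul_eq_mul, Complex.ofReal_natCast]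
    ring
  have hi : ∀ a b, Integrable (fun ψ : CSphere d => Δ a b * ((d : ℂ) • rankOne ψ.1) b a)
      (uniformSphere d) := fun a b => ((integrable_rankOne b a).const_mul (d : ℂ)).const_mul _
  simp_rw [h1, ← RCLike.re_eq_complex_re]
  rw [integral_re (integrable_finsetSum _ fun a _ => integrable_finsetSum _ fun b _ => hi a b),
    integral_finsetSum _ fun a _ => integrable_finsetSum _ fun b _ => hi a b]
  simp_rw [fun a => integral_finsetSum Finset.univ fun b _ => hi a b]
  congr 1
  refine Finset.sum_congr rfl fun a _ => ?_
  simp_rw [integral_const_mul, integral_rankOne]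
  simp [Matrix.one_apply]

theorem integrable_scaledExpect {d : ℕ} (Δ : Matrix (Fin d) (Fin d) ℂ) :
    Integrable (scaledExpect Δ) (uniformSphere d) :=
  (continuous_scaledExpect Δ).integrable_uniformSphere

theorem abs_re_trace_le_uniformNorm {d : ℕ} (Δ : Matrix (Fin d) (Fin d) ℂ) :
    |Δ.trace.re| ≤ uniformNorm Δ := by
  rw [← integral_scaledExpect]
  exact abs_integral_le_integral_abs

theorem uniformNorm_nonneg {d : ℕ} (Δ : Matrix (Fin d) (Fin d) ℂ) : 0 ≤ uniformNorm Δ :=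
  integral_nonneg fun _ => abs_nonneg _

/-- Take `t = 1/‖Δ‖`. The characteristic function then has squared modulus `∏ (1 + t²λᵢ²)⁻¹`, at
most `1/2` since the `t²λᵢ²` sum to `1`. Its real part is therefore at most `3/4`, and the first
moment is at least `‖Δ‖/4`. -/
theorem frobenius_norm_le_uniformNorm {d : ℕ} [NeZero d] {Δ : Matrix (Fin d) (Fin d) ℂ}
    (hΔ : Δ.IsHermitian) : ‖Δ‖ ≤ 4 * uniformNorm Δ := by
  rcases eq_or_lt_of_le (norm_nonneg Δ) with h0 | hpos
  · rw [← h0]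
    exact mul_nonneg (by norm_num) (uniformNorm_nonneg Δ)
  have h := one_sub_re_prod_le_uniformNorm hΔ (inv_nonneg.2 hpos.le)
  set t := ‖Δ‖⁻¹ with ht
  set w := ∏ i, (1 - ((t : ℂ) * Complex.I) * hΔ.eigenvalues i)⁻¹ with hw
  have hn : ‖w‖ ^ 2 ≤ 1 / 2 := by
    have h1 : ∀ i, ‖(1 - ((t : ℂ) * Complex.I) * hΔ.eigenvalues i)⁻¹‖ ^ 2
        = (1 + t ^ 2 * hΔ.eigenvalues i ^ 2)⁻¹ := by
      intro i
      rw [norm_inv, inv_pow, ← Complex.normSq_eq_norm_sq, Complex.normSq_apply]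
      congr 1
      simp
      ring
    rw [hw, norm_prod, ← Finset.prod_pow, Finset.prod_congr rfl fun i _ => h1 i,
      Finset.prod_inv_distrib, one_div]
    refine inv_anti₀ (by norm_num) ?_
    refine le_trans (le_of_eq ?_) (one_add_sum_le_prod_one_add _ fun i => by positivity)
    rw [← Finset.mul_sum, ← frobenius_norm_sq_eq_sum_eigenvalues hΔ, ht]
    field_simp
    norm_num
  have hre : w.re ≤ 3 / 4 := by
    refine (Complex.re_le_norm w).trans ?_
    nlinarith [norm_nonneg w]
  have h2 : 1 / 4 ≤ t * uniformNorm Δ := by linarith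
  have h3 := mul_le_mul_of_nonneg_left h2 hpos.le
  rw [ht, ← mul_assoc, mul_inv_cancel₀ hpos.ne', one_mul] at h3
  linarith

/-- Factor by factor, `(1 - y)⁻¹ ≤ exp (y + 2y²)` for `|y| ≤ 1/2`. The eigenvalues sum to the trace
and their squares to the squared Frobenius norm. -/
theorem integral_exp_scaledExpect_le_exp {d : ℕ} [NeZero d] {Δ : Matrix (Fin d) (Fin d) ℂ}
    (hΔ : Δ.IsHermitian) {t : ℝ} (ht : |t| * ‖Δ‖ ≤ 1 / 2) :
    ∫ ψ, Real.exp (t * scaledExpect Δ ψ) ∂(uniformSphere d)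
      ≤ Real.exp (t * Δ.trace.re + 2 * t ^ 2 * ‖Δ‖ ^ 2) := by
  have hlam : ∀ i, |t * hΔ.eigenvalues i| ≤ 1 / 2 := fun i => by
    rw [abs_mul]
    exact (mul_le_mul_of_nonneg_left (abs_eigenvalue_le_frobenius hΔ i) (abs_nonneg t)).trans ht
  refine (integral_exp_scaledExpect_le hΔ t fun i => ?_).trans ?_
  · have := (abs_le.1 (hlam i)).2
    linarith
  have htr : Δ.trace.re = ∑ i, hΔ.eigenvalues i := by
    rw [hΔ.trace_eq_sum_eigenvalues, Complex.re_sum]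
    rfl
  rw [htr, frobenius_norm_sq_eq_sum_eigenvalues hΔ, Finset.mul_sum, Finset.mul_sum,
    ← Finset.sum_add_distrib, Real.exp_sum]
  have key : ∀ y : ℝ, |y| ≤ 1 / 2 → (1 - y)⁻¹ ≤ Real.exp (y + 2 * y ^ 2) := by
    intro y hy
    have h1 := abs_le.1 hy
    have h2 : 0 < 1 - y := by linarith
    rw [inv_le_iff_one_le_mul₀ h2]
    have h3 := mul_le_mul_of_nonneg_right (Real.add_one_le_exp (y + 2 * y ^ 2)) h2.le
    nlinarith [mul_nonneg (sq_nonneg y) (by linarith : (0 : ℝ) ≤ 1 - 2 * y)]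
  refine Finset.prod_le_prod (fun i _ => ?_) fun i _ => ?_
  · have := (abs_le.1 (hlam i)).2
    exact inv_nonneg.2 (by linarith)
  · refine (key _ (hlam i)).trans (le_of_eq ?_)
    congr 1
    ring

theorem integral_exp_abs_scaledExpect_le {d : ℕ} [NeZero d] {Δ : Matrix (Fin d) (Fin d) ℂ}
    (hΔ : Δ.IsHermitian) {t : ℝ} (ht0 : 0 ≤ t) (ht : t * ‖Δ‖ ≤ 1 / 2) :
    ∫ ψ, Real.exp (t * |scaledExpect Δ ψ|) ∂(uniformSphere d)
      ≤ 2 * Real.exp (t * |Δ.trace.re| + 2 * t ^ 2 * ‖Δ‖ ^ 2) := by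
  have hc := continuous_scaledExpect Δ
  have hi : ∀ s : ℝ, Integrable (fun ψ => Real.exp (s * scaledExpect Δ ψ)) (uniformSphere d) :=
    fun s => Continuous.integrable_uniformSphere (by fun_prop)
  have h1 : ∫ ψ, Real.exp (t * |scaledExpect Δ ψ|) ∂(uniformSphere d)
      ≤ ∫ ψ, (Real.exp (t * scaledExpect Δ ψ) + Real.exp (-t * scaledExpect Δ ψ))
        ∂(uniformSphere d) := by
    refine integral_mono (Continuous.integrable_uniformSphere (by fun_prop))
      ((hi t).add (hi (-t))) fun ψ => ?_
    dsimp only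
    rcases abs_cases (scaledExpect Δ ψ) with ⟨h, _⟩ | ⟨h, _⟩ <;> rw [h]
    · linarith [Real.exp_pos (-t * scaledExpect Δ ψ)]
    · rw [mul_neg, ← neg_mul]
      linarith [Real.exp_pos (t * scaledExpect Δ ψ)]
  rw [integral_add (hi t) (hi (-t))] at h1
  have h2 : ∀ s : ℝ, |s| = t → ∫ ψ, Real.exp (s * scaledExpect Δ ψ) ∂(uniformSphere d)
      ≤ Real.exp (t * |Δ.trace.re| + 2 * t ^ 2 * ‖Δ‖ ^ 2) := by
    intro s hs
    refine (integral_exp_scaledExpect_le_exp hΔ (by rwa [hs])).trans (Real.exp_le_exp.2 ?_)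
    rw [← sq_abs s, ← hs, ← abs_mul]
    gcongr
    exact le_abs_self _
  linarith [h2 t (abs_of_nonneg ht0), h2 (-t) (by rw [abs_neg, abs_of_nonneg ht0])]

/-- Here the Frobenius norm is at most `4` and the absolute trace at most `1`, so at `t = 1/8` the
exponent is at most `1/8 + 1/2 < log 2`. This dimension-free moment is the input of the Bernstein
bound. -/
theorem integral_exp_abs_scaledExpect_le_four {d : ℕ} [NeZero d] {Δ : Matrix (Fin d) (Fin d) ℂ}
    (hΔ : Δ.IsHermitian) (h1 : uniformNorm Δ ≤ 1) :
    ∫ ψ, Real.exp (1 / 8 * |scaledExpect Δ ψ|) ∂(uniformSphere d) ≤ 4 := by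
  have hF := frobenius_norm_le_uniformNorm hΔ
  have ht := abs_re_trace_le_uniformNorm Δ
  refine (integral_exp_abs_scaledExpect_le hΔ (by norm_num) (by linarith)).trans ?_
  have h2 : Real.exp (1 / 8 * |Δ.trace.re| + 2 * (1 / 8) ^ 2 * ‖Δ‖ ^ 2) ≤ 2 := by
    rw [← Real.le_log_iff_exp_le (by norm_num)]
    have := Real.log_two_gt_d9
    nlinarith [norm_nonneg Δ]
  linarith

/-- At `t = 1/(2N)` the exponential moment of `t|X|` is at most `2e ≤ 6` and dominates `t E|X|`,
which gives `E|X| ≤ 12N`. -/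
theorem uniformNorm_le {d : ℕ} [NeZero d] {Δ : Matrix (Fin d) (Fin d) ℂ}
    (hΔ : Δ.IsHermitian) : uniformNorm Δ ≤ 12 * (‖Δ‖ + ‖Δ.trace‖) := by
  have hre : |Δ.trace.re| ≤ ‖Δ.trace‖ := Complex.abs_re_le_norm _
  rcases eq_or_lt_of_le (add_nonneg (norm_nonneg Δ) (norm_nonneg Δ.trace)) with h0 | hpos
  · have : Δ = 0 := norm_eq_zero.1 (by linarith [norm_nonneg Δ, norm_nonneg Δ.trace])
    subst this
    simp [uniformNorm, scaledExpect, expect]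
  set N := ‖Δ‖ + ‖Δ.trace‖ with hN
  have hc := continuous_scaledExpect Δ
  set t := (2 * N)⁻¹ with ht
  have ht0 : 0 ≤ t := by positivity
  have htN : t * N = 1 / 2 := by rw [ht]; field_simp
  have htF : t * ‖Δ‖ ≤ 1 / 2 := by
    rw [← htN]
    exact mul_le_mul_of_nonneg_left (by linarith [norm_nonneg Δ.trace]) ht0
  have htT : t * |Δ.trace.re| ≤ 1 / 2 := by
    rw [← htN]
    exact mul_le_mul_of_nonneg_left (by linarith [norm_nonneg Δ]) ht0
  have h1 := integral_exp_abs_scaledExpect_le hΔ ht0 htF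
  have h2 : t * uniformNorm Δ ≤ ∫ ψ, Real.exp (t * |scaledExpect Δ ψ|) ∂(uniformSphere d) := by
    rw [uniformNorm, ← integral_const_mul]
    refine integral_mono (Continuous.integrable_uniformSphere (by fun_prop))
      (Continuous.integrable_uniformSphere (by fun_prop)) fun ψ => ?_
    have := Real.add_one_le_exp (t * |scaledExpect Δ ψ|)
    dsimp only
    linarith
  have h3 : Real.exp (t * |Δ.trace.re| + 2 * t ^ 2 * ‖Δ‖ ^ 2) ≤ 3 := by
    refine (Real.exp_le_exp.2 ?_).trans Real.exp_one_lt_three.le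
    have : 0 ≤ t * ‖Δ‖ := by positivity
    nlinarith
  have h4 : t * uniformNorm Δ ≤ 6 := by linarith
  have h5 := mul_le_mul_of_nonneg_left h4 (by positivity : (0 : ℝ) ≤ 2 * N)
  rw [← mul_assoc, ht, mul_inv_cancel₀ (by positivity), one_mul] at h5
  linarith

end Frobenius

/-! ### Linearity of the expectation and the seminorm laws -/

theorem expect_add {d : ℕ} (A B : Matrix (Fin d) (Fin d) ℂ) (x : EuclideanSpace ℂ (Fin d)) :
    expect (A + B) x = expect A x + expect B x := by
  simp [expect, Matrix.add_mul]

theorem expect_real_smul {d : ℕ} (r : ℝ) (A : Matrix (Fin d) (Fin d) ℂ)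
    (x : EuclideanSpace ℂ (Fin d)) : expect (r • A) x = r * expect A x := by
  rw [expect, Matrix.smul_mul, Matrix.trace_smul, Complex.smul_re, smul_eq_mul, expect]

theorem scaledExpect_add {d : ℕ} (A B : Matrix (Fin d) (Fin d) ℂ) (ψ : CSphere d) :
    scaledExpect (A + B) ψ = scaledExpect A ψ + scaledExpect B ψ := by
  rw [scaledExpect, expect_add, mul_add, scaledExpect, scaledExpect]

theorem scaledExpect_real_smul {d : ℕ} (r : ℝ) (A : Matrix (Fin d) (Fin d) ℂ) (ψ : CSphere d) :
    scaledExpect (r • A) ψ = r * scaledExpect A ψ := by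
  rw [scaledExpect, expect_real_smul, scaledExpect]
  ring

theorem uniformNorm_add_le {d : ℕ} (A B : Matrix (Fin d) (Fin d) ℂ) :
    uniformNorm (A + B) ≤ uniformNorm A + uniformNorm B := by
  have hA := (integrable_scaledExpect A).abs
  have hB := (integrable_scaledExpect B).abs
  rw [uniformNorm, uniformNorm, uniformNorm, ← integral_add hA hB]
  refine integral_mono (integrable_scaledExpect _).abs (hA.add hB) fun ψ => ?_
  dsimp only
  rw [scaledExpect_add]
  exact abs_add_le _ _

theorem uniformNorm_real_smul {d : ℕ} (r : ℝ) (A : Matrix (Fin d) (Fin d) ℂ) :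
    uniformNorm (r • A) = |r| * uniformNorm A := by
  simp only [uniformNorm, scaledExpect_real_smul, abs_mul, integral_const_mul]

/-! ### A Bernstein inequality for sums of independent sub-exponential variables -/

theorem exp_le_one_add_add_sq_mul_exp_abs (x : ℝ) :
    Real.exp x ≤ 1 + x + x ^ 2 * Real.exp |x| := by
  have h1 : 1 ≤ Real.exp |x| := Real.one_le_exp (abs_nonneg x)
  rcases le_or_gt |x| 1 with h | h
  · have := (abs_le.1 (Real.abs_exp_sub_one_sub_id_le h)).2
    nlinarith [sq_nonneg x]
  · have h2 : 1 ≤ x ^ 2 := by rw [← sq_abs]; nlinarith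
    rcases abs_cases x with ⟨hx, h0⟩ | ⟨hx, h0⟩
    · rw [hx] at h1 ⊢
      nlinarith
    · have h3 : Real.exp x ≤ 1 := Real.exp_le_one_iff.2 h0.le
      nlinarith

theorem integral_exp_mul_le_of_integral_exp_abs_le {X : Type*} [MeasurableSpace X] {μ : Measure X}
    [IsProbabilityMeasure μ] {Z : X → ℝ} (hZ : Integrable Z μ)
    (hexp : Integrable (fun x => Real.exp (1 / 8 * |Z x|)) μ)
    (h4 : ∫ x, Real.exp (1 / 8 * |Z x|) ∂μ ≤ 4) {s : ℝ} (hs : |s| ≤ 1 / 16) :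
    Integrable (fun x => Real.exp (s * Z x)) μ ∧
      ∫ x, Real.exp (s * Z x) ∂μ ≤ Real.exp (s * ∫ x, Z x ∂μ + 2048 * s ^ 2) := by
  have hsZ : ∀ x, |s * Z x| ≤ 1 / 16 * |Z x| := fun x => by
    rw [abs_mul]
    exact mul_le_mul_of_nonneg_right hs (abs_nonneg _)
  have hi : Integrable (fun x => Real.exp (s * Z x)) μ := by
    refine hexp.mono' (Real.continuous_exp.comp_aestronglyMeasurable
      (hZ.aestronglyMeasurable.const_mul s)) (Filter.Eventually.of_forall fun x => ?_)
    rw [Real.norm_eq_abs, abs_of_pos (Real.exp_pos _)]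
    refine Real.exp_le_exp.2 ((le_abs_self _).trans ((hsZ x).trans ?_))
    have := abs_nonneg (Z x)
    linarith
  refine ⟨hi, ?_⟩
  have hpt : ∀ x, Real.exp (s * Z x)
      ≤ 1 + s * Z x + 512 * s ^ 2 * Real.exp (1 / 8 * |Z x|) := by
    intro x
    refine (exp_le_one_add_add_sq_mul_exp_abs _).trans (add_le_add_right ?_ _)
    have h1 : Real.exp |s * Z x| ≤ Real.exp (1 / 16 * |Z x|) := Real.exp_le_exp.2 (hsZ x)
    -- With `y = |Z x|/16`, the bound `y²/2 ≤ exp y` gives `512 = 2·16²`. The two factors `exp y`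
    -- combine into the available moment at `1/8`, and `2048 = 512·4`.
    have h2 : (Z x) ^ 2 ≤ 512 * Real.exp (1 / 16 * |Z x|) := by
      have := Real.quadratic_le_exp_of_nonneg (x := 1 / 16 * |Z x|) (by positivity)
      have h3 := abs_nonneg (Z x)
      nlinarith [sq_abs (Z x)]
    have h3 : Real.exp (1 / 8 * |Z x|)
        = Real.exp (1 / 16 * |Z x|) * Real.exp (1 / 16 * |Z x|) := by
      rw [← Real.exp_add]
      congr 1
      ring
    calc (s * Z x) ^ 2 * Real.exp |s * Z x|
        = s ^ 2 * (Z x ^ 2 * Real.exp |s * Z x|) := by ring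
      _ ≤ s ^ 2 * (512 * Real.exp (1 / 16 * |Z x|) * Real.exp (1 / 16 * |Z x|)) := by gcongr
      _ = _ := by rw [h3]; ring
  have hlin : Integrable (fun x => 1 + s * Z x) μ := (integrable_const _).add (hZ.const_mul s)
  have hint := integral_mono hi (hlin.add (hexp.const_mul (512 * s ^ 2))) hpt
  rw [integral_add' hlin (hexp.const_mul _), integral_add (integrable_const _) (hZ.const_mul s),
    integral_const_mul, integral_const_mul] at hint
  simp only [integral_const, probReal_univ, smul_eq_mul, mul_one] at hint
  refine hint.trans (le_trans ?_ (Real.add_one_le_exp _))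
  nlinarith [mul_le_mul_of_nonneg_left h4 (sq_nonneg s)]

theorem measure_pi_sum_ge_le {X : Type*} [MeasurableSpace X] {μ : Measure X}
    [IsProbabilityMeasure μ] {Z : X → ℝ} (hZ : Integrable Z μ)
    (hexp : Integrable (fun x => Real.exp (1 / 8 * |Z x|)) μ)
    (h4 : ∫ x, Real.exp (1 / 8 * |Z x|) ∂μ ≤ 4) {δ : ℝ} (hδ0 : 0 ≤ δ) (hδ1 : δ ≤ 1) (n : ℕ) :
    (Measure.pi fun _ : Fin n => μ).real {ω | n * (∫ x, Z x ∂μ + δ) ≤ ∑ j, Z (ω j)}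
      ≤ Real.exp (-(n * δ ^ 2 / 8192)) := by
  -- The minimizer of `-sδ + 2048 s²`, with minimum `-δ²/8192`.
  set s := δ / 4096 with hs
  have hs0 : 0 ≤ s := by positivity
  obtain ⟨hi, hle⟩ := integral_exp_mul_le_of_integral_exp_abs_le hZ hexp h4
    (s := s) (by rw [abs_of_nonneg hs0]; linarith)
  have hprod : (fun ω : Fin n → X => Real.exp (s * ∑ j, Z (ω j)))
      = fun ω => ∏ j, Real.exp (s * Z (ω j)) := by
    ext ω
    rw [Finset.mul_sum, Real.exp_sum]
  have hint : Integrable (fun ω : Fin n → X => Real.exp (s * ∑ j, Z (ω j)))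
      (Measure.pi fun _ : Fin n => μ) := by
    rw [hprod]
    exact Integrable.fintype_prod fun _ => hi
  refine (measure_ge_le_exp_mul_mgf _ hs0 hint).trans ?_
  rw [mgf, hprod, integral_fintype_prod_eq_pow (fun x => Real.exp (s * Z x)), Fintype.card_fin]
  have h0 : 0 ≤ ∫ x, Real.exp (s * Z x) ∂μ := integral_nonneg fun _ => (Real.exp_pos _).le
  refine (mul_le_mul_of_nonneg_left (pow_le_pow_left₀ h0 hle n) (Real.exp_pos _).le).trans ?_
  rw [← Real.exp_nat_mul, ← Real.exp_add, hs]
  refine Real.exp_le_exp.2 (le_of_eq ?_)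
  ring

theorem measure_pi_abs_sum_sub_ge_le {X : Type*} [MeasurableSpace X] {μ : Measure X}
    [IsProbabilityMeasure μ] {Z : X → ℝ} (hZ : Integrable Z μ)
    (hexp : Integrable (fun x => Real.exp (1 / 8 * |Z x|)) μ)
    (h4 : ∫ x, Real.exp (1 / 8 * |Z x|) ∂μ ≤ 4) {δ : ℝ} (hδ0 : 0 ≤ δ) (hδ1 : δ ≤ 1) (n : ℕ) :
    (Measure.pi fun _ : Fin n => μ).real {ω | n * δ ≤ |∑ j, Z (ω j) - n * ∫ x, Z x ∂μ|}
      ≤ 2 * Real.exp (-(n * δ ^ 2 / 8192)) := by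
  have h1 := measure_pi_sum_ge_le hZ hexp h4 hδ0 hδ1 n
  have h2 := measure_pi_sum_ge_le (Z := fun x => -Z x) hZ.neg (by simpa using hexp)
    (by simpa using h4) hδ0 hδ1 n
  have hsub : {ω : Fin n → X | n * δ ≤ |∑ j, Z (ω j) - n * ∫ x, Z x ∂μ|}
      ⊆ {ω | n * (∫ x, Z x ∂μ + δ) ≤ ∑ j, Z (ω j)}
        ∪ {ω | n * (∫ x, -Z x ∂μ + δ) ≤ ∑ j, -Z (ω j)} := by
    intro ω hω
    simp only [Set.mem_union, Set.mem_ofPred_eq, integral_neg, Finset.sum_neg_distrib] at hω ⊢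
    rcases le_abs.1 hω with h | h
    · left; linarith
    · right; linarith
  refine (measureReal_mono hsub).trans ((measureReal_union_le _ _).trans ?_)
  linarith

/-! ### Nets in finite-dimensional normed spaces -/

/-- A maximal 1-separated subset of the ball of radius `2` is a 1-net of that ball, and a volume
bound limits its size. Scaling by `1/2` yields the net. -/
theorem exists_half_net (E : Type*) [NormedAddCommGroup E] [NormedSpace ℝ E]
    [FiniteDimensional ℝ E] :
    ∃ s : Finset E, s.card ≤ 5 ^ Module.finrank ℝ E ∧ (∀ c ∈ s, ‖c‖ ≤ 1) ∧
      ∀ x : E, ‖x‖ ≤ 1 → ∃ c ∈ s, ‖x - c‖ ≤ 1 / 2 := by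
  classical
  let good : Finset E → Prop := fun s => (∀ c ∈ s, ‖c‖ ≤ 2) ∧
    ∀ c ∈ s, ∀ c' ∈ s, c ≠ c' → 1 ≤ ‖c - c'‖
  let cards : Set ℕ := {m | ∃ s, good s ∧ s.card = m}
  have hbdd : BddAbove cards := by
    refine ⟨5 ^ Module.finrank ℝ E, ?_⟩
    rintro m ⟨s, hs, rfl⟩
    exact Besicovitch.card_le_of_separated s hs.1 hs.2
  have hne : cards.Nonempty := ⟨0, ∅, ⟨by simp, by simp⟩, rfl⟩
  obtain ⟨s, hs, hcard⟩ := Nat.sSup_mem hne hbdd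
  have hcov : ∀ x : E, ‖x‖ ≤ 2 → ∃ c ∈ s, ‖x - c‖ ≤ 1 := by
    intro x hx
    by_contra! hcon
    have hxs : x ∉ s := fun h => by
      have := hcon x h
      simp at this
      linarith
    have hg : good (insert x s) := by
      refine ⟨fun c hc => ?_, fun c hc c' hc' hne' => ?_⟩
      · rcases Finset.mem_insert.1 hc with rfl | h
        · exact hx
        · exact hs.1 c h
      · rcases Finset.mem_insert.1 hc with rfl | h <;> rcases Finset.mem_insert.1 hc' with rfl | h'
        · exact absurd rfl hne'
        · exact (hcon c' h').le
        · rw [norm_sub_rev]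
          exact (hcon c h).le
        · exact hs.2 c h c' h' hne'
    have := le_csSup hbdd ⟨insert x s, hg, rfl⟩
    rw [Finset.card_insert_of_notMem hxs, ← hcard] at this
    omega
  refine ⟨s.image fun c => (1 / 2 : ℝ) • c, ?_, ?_, fun x hx => ?_⟩
  · exact Finset.card_image_le.trans (Besicovitch.card_le_of_separated s hs.1 hs.2)
  · intro c hc
    obtain ⟨c', hc', rfl⟩ := Finset.mem_image.1 hc
    rw [norm_smul]
    have := hs.1 c' hc'
    norm_num
    linarith
  · obtain ⟨c, hc, hxc⟩ := hcov ((2 : ℝ) • x) (by rw [norm_smul]; norm_num; linarith)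
    refine ⟨_, Finset.mem_image_of_mem _ hc, ?_⟩
    have : x - (1 / 2 : ℝ) • c = (1 / 2 : ℝ) • ((2 : ℝ) • x - c) := by
      rw [smul_sub, smul_smul]
      norm_num
    rw [this, norm_smul]
    norm_num
    linarith

/-- Successive binary corrections: the residue at scale `2⁻ˡ` is rescaled to the unit ball and
approximated within `1/2` there. The norms of the corrections form a geometric series below `2`. -/
theorem exists_net (E : Type*) [NormedAddCommGroup E] [NormedSpace ℝ E]
    [FiniteDimensional ℝ E] (l : ℕ) :
    ∃ s : Finset E, s.card ≤ (5 ^ Module.finrank ℝ E) ^ l ∧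
      (∀ c ∈ s, ‖c‖ ≤ 2 - 2 * (1 / 2) ^ l) ∧
      ∀ x : E, ‖x‖ ≤ 1 → ∃ c ∈ s, ‖x - c‖ ≤ (1 / 2) ^ l := by
  classical
  induction l with
  | zero => exact ⟨{0}, by simp, by simp, fun x hx => ⟨0, by simp, by simpa using hx⟩⟩
  | succ l ih =>
    obtain ⟨s, hs, hsn, hsc⟩ := ih
    obtain ⟨t, ht, htn, htc⟩ := exists_half_net E
    refine ⟨(s ×ˢ t).image fun p => p.1 + ((1 / 2 : ℝ) ^ l) • p.2, ?_, ?_, fun x hx => ?_⟩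
    · refine Finset.card_image_le.trans ?_
      rw [Finset.card_product, pow_succ]
      exact Nat.mul_le_mul hs ht
    · intro c hc
      obtain ⟨⟨a, b⟩, hab, rfl⟩ := Finset.mem_image.1 hc
      obtain ⟨ha, hb⟩ := Finset.mem_product.1 hab
      refine (norm_add_le _ _).trans ?_
      have h1 := hsn a ha
      have h2 := htn b hb
      have h3 : (0 : ℝ) ≤ (1 / 2) ^ l := by positivity
      rw [norm_smul, Real.norm_of_nonneg h3, pow_succ]
      dsimp only at *
      nlinarith
    · obtain ⟨a, ha, hxa⟩ := hsc x hx
      have h3 : (0 : ℝ) < (1 / 2) ^ l := by positivity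
      obtain ⟨b, hb, hxb⟩ := htc (((1 / 2 : ℝ) ^ l)⁻¹ • (x - a)) (by
        rw [norm_smul, norm_inv, Real.norm_of_nonneg h3.le]
        exact inv_mul_le_one_of_le₀ hxa h3.le)
      refine ⟨_, Finset.mem_image_of_mem _ (Finset.mk_mem_product ha hb), ?_⟩
      have : x - (a + ((1 / 2 : ℝ) ^ l) • b)
          = ((1 / 2 : ℝ) ^ l) • ((((1 / 2 : ℝ) ^ l)⁻¹ • (x - a)) - b) := by
        rw [smul_sub, smul_smul, mul_inv_cancel₀ h3.ne', one_smul]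
        abel
      rw [this, norm_smul, Real.norm_of_nonneg h3.le, pow_succ]
      exact mul_le_mul_of_nonneg_left hxb h3.le

/-- A net for the unit ball of a norm that is given as a plain function. -/
theorem exists_net_of_isNorm {E : Type*} [AddCommGroup E] [Module ℝ E] [FiniteDimensional ℝ E]
    (p : E → ℝ) (hp0 : ∀ x, 0 ≤ p x) (hadd : ∀ x y, p (x + y) ≤ p x + p y)
    (hsmul : ∀ (r : ℝ) x, p (r • x) = |r| * p x) (hdef : ∀ x, p x = 0 → x = 0) (l : ℕ) :
    ∃ s : Finset E, s.card ≤ (5 ^ Module.finrank ℝ E) ^ l ∧ (∀ c ∈ s, p c ≤ 2) ∧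
      ∀ x : E, p x ≤ 1 → ∃ c ∈ s, p (x - c) ≤ (1 / 2) ^ l := by
  let : Norm E := ⟨p⟩
  have hcore : NormedSpace.Core ℝ E :=
    { norm_nonneg := hp0
      norm_smul := hsmul
      norm_triangle := hadd
      norm_eq_zero_iff := fun x => ⟨hdef x, fun h => by
        have := hsmul 0 0
        rw [zero_smul, abs_zero, zero_mul] at this
        rw [h]
        exact this⟩ }
  let : NormedAddCommGroup E := NormedAddCommGroup.ofCore hcore
  let : NormedSpace ℝ E := NormedSpace.ofCore hcore
  obtain ⟨s, hs, hn, hc⟩ := exists_net E l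
  refine ⟨s, hs, fun c h => (hn c h).trans ?_, hc⟩
  have : (0 : ℝ) ≤ (1 / 2) ^ l := by positivity
  linarith

theorem uniformNorm_definite {d : ℕ} [NeZero d] {Δ : Matrix (Fin d) (Fin d) ℂ}
    (hΔ : Δ.IsHermitian) (h : uniformNorm Δ = 0) : Δ = 0 := by
  open scoped Matrix.Norms.Frobenius in
  have := frobenius_norm_le_uniformNorm hΔ
  rw [h, mul_zero] at this
  exact norm_le_zero_iff.1 this

/-- The net is built for the uniform norm on the real space of Hermitian matrices, whose dimension
is bounded crudely by that of all complex matrices. Halving brings the points into the unit ball,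
where the exponential moment bound holds, at the price of covering only radius `1/2`. -/
theorem exists_uniformNorm_net (d : ℕ) [NeZero d] (l : ℕ) :
    ∃ s : Finset (Matrix (Fin d) (Fin d) ℂ), s.card ≤ 5 ^ (2 * d ^ 2 * l) ∧
      (∀ c ∈ s, c.IsHermitian ∧ uniformNorm c ≤ 1) ∧
      ∀ Δ : Matrix (Fin d) (Fin d) ℂ, Δ.IsHermitian → uniformNorm Δ ≤ 1 / 2 →
        ∃ c ∈ s, uniformNorm (Δ - c) ≤ (1 / 2) ^ (l + 1) := by
  classical
  let E := selfAdjoint.submodule ℝ (Matrix (Fin d) (Fin d) ℂ)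
  have hfin : Module.finrank ℝ E ≤ 2 * d ^ 2 := by
    refine (Submodule.finrank_le E).trans (le_of_eq ?_)
    rw [← Module.finrank_mul_finrank ℝ ℂ, Complex.finrank_real_complex, Module.finrank_matrix]
    simp
    ring
  obtain ⟨s, hs, hn, hc⟩ := exists_net_of_isNorm (E := E) (fun x => uniformNorm x.1)
    (fun x => uniformNorm_nonneg _) (fun x y => uniformNorm_add_le _ _)
    (fun r x => uniformNorm_real_smul r _)
    (fun x hx => Subtype.ext (uniformNorm_definite x.2 hx)) l
  refine ⟨s.image fun c => ((1 / 2 : ℝ) • c).1, ?_, ?_, fun Δ hΔ h1 => ?_⟩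
  · refine Finset.card_image_le.trans (hs.trans ?_)
    rw [← pow_mul]
    exact Nat.pow_le_pow_right (by norm_num) (Nat.mul_le_mul_right l hfin)
  · intro c hc
    obtain ⟨c', hc', rfl⟩ := Finset.mem_image.1 hc
    refine ⟨((1 / 2 : ℝ) • c').2, ?_⟩
    have h2 : uniformNorm ((1 / 2 : ℝ) • c').1 = |1 / 2| * uniformNorm c'.1 :=
      uniformNorm_real_smul _ _
    rw [h2]
    have := hn c' hc'
    norm_num
    linarith
  · obtain ⟨c, hcs, hcd⟩ := hc ((2 : ℝ) • ⟨Δ, hΔ⟩) (by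
      have : uniformNorm ((2 : ℝ) • (⟨Δ, hΔ⟩ : E)).1 = |2| * uniformNorm Δ :=
        uniformNorm_real_smul _ _
      rw [this]
      norm_num
      linarith)
    refine ⟨_, Finset.mem_image_of_mem _ hcs, ?_⟩
    have h2 : Δ - ((1 / 2 : ℝ) • c).1 = (1 / 2 : ℝ) • ((2 : ℝ) • (⟨Δ, hΔ⟩ : E) - c).1 := by
      have : ((2 : ℝ) • (⟨Δ, hΔ⟩ : E) - c).1 = (2 : ℝ) • Δ - c.1 := rfl
      rw [this, smul_sub, smul_smul]
      norm_num
    rw [h2, uniformNorm_real_smul, pow_succ]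
    norm_num at hcd ⊢
    linarith

/-! ### Random samples approximate the uniform norm -/

/-- The empirical version of `uniformNorm` for a sample `ω` of unit vectors. -/
def empiricalNorm {d n : ℕ} (ω : Fin n → CSphere d) (Δ : Matrix (Fin d) (Fin d) ℂ) : ℝ :=
  (∑ j, |scaledExpect Δ (ω j)|) / n

/-- The empirical version of the trace for a sample `ω` of unit vectors. -/
def empiricalMean {d n : ℕ} (ω : Fin n → CSphere d) (Δ : Matrix (Fin d) (Fin d) ℂ) : ℝ :=
  (∑ j, scaledExpect Δ (ω j)) / n

/-- The sample `ω` reproduces the uniform norm and the trace of all Hermitian matrices, up to a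
relative error `δ` with respect to the uniform norm. -/
def IsApproximating {d n : ℕ} (δ : ℝ) (ω : Fin n → CSphere d) : Prop :=
  ∀ Δ : Matrix (Fin d) (Fin d) ℂ, Δ.IsHermitian →
    |empiricalNorm ω Δ - uniformNorm Δ| ≤ δ * uniformNorm Δ ∧
    |empiricalMean ω Δ - Δ.trace.re| ≤ δ * uniformNorm Δ

theorem le_mul_uniformNorm_of_homogeneous {d : ℕ} [NeZero d] {F : Matrix (Fin d) (Fin d) ℂ → ℝ}
    (hF : ∀ (r : ℝ) Δ, F (r • Δ) = |r| * F Δ) {B : ℝ}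
    (h : ∀ Δ : Matrix (Fin d) (Fin d) ℂ, Δ.IsHermitian → uniformNorm Δ = 1 / 2 → F Δ ≤ B / 2)
    (Δ : Matrix (Fin d) (Fin d) ℂ) (hΔ : Δ.IsHermitian) : F Δ ≤ B * uniformNorm Δ := by
  rcases eq_or_lt_of_le (uniformNorm_nonneg Δ) with h0 | hpos
  · have h1 := hF 0 Δ
    rw [zero_smul, abs_zero, zero_mul] at h1
    rw [← h0, uniformNorm_definite hΔ h0.symm, h1, mul_zero]
  · have hr : (0 : ℝ) < (2 * uniformNorm Δ)⁻¹ := by positivity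
    have h1 := h ((2 * uniformNorm Δ)⁻¹ • Δ) (hΔ.smul (IsSelfAdjoint.all _)) (by
      rw [uniformNorm_real_smul, abs_of_pos hr]
      field_simp)
    rw [hF, abs_of_pos hr, inv_mul_le_iff₀ (by positivity)] at h1
    linarith

/-- A crude starting bound: a rank one projection has Frobenius norm `1`. Its dependence on `d` is
removed by the iteration in `isApproximating_of_net`. -/
theorem abs_scaledExpect_le {d : ℕ} [NeZero d] {Δ : Matrix (Fin d) (Fin d) ℂ}
    (hΔ : Δ.IsHermitian) (ψ : CSphere d) : |scaledExpect Δ ψ| ≤ 4 * d * uniformNorm Δ := by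
  open scoped Matrix.Norms.Frobenius in
  have h1 : ‖rankOne ψ.1‖ ≤ 1 := by
    have h2 : ∑ a, ‖ψ.1 a‖ ^ 2 = 1 := by
      rw [← EuclideanSpace.norm_sq_eq, norm_eq_of_mem_sphere ψ, one_pow]
    have h3 : ‖rankOne ψ.1‖ ^ 2 ≤ 1 ^ 2 := by
      rw [frobenius_norm_sq_eq_sum]
      simp only [rankOne, vecMulVec_apply, norm_mul, mul_pow, ← Finset.mul_sum, Pi.star_apply,
        norm_star, h2, mul_one, one_pow, le_refl]
    exact le_of_sq_le_sq h3 zero_le_one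
  have h2 : |expect Δ ψ.1| ≤ 4 * uniformNorm Δ := by
    refine (Complex.abs_re_le_norm _).trans ((norm_trace_mul_le _ _).trans ?_)
    have := frobenius_norm_le_uniformNorm hΔ
    nlinarith [norm_nonneg Δ, norm_nonneg (rankOne ψ.1)]
  rw [scaledExpect, abs_mul, Nat.abs_cast]
  nlinarith [(Nat.cast_nonneg d : (0 : ℝ) ≤ d)]

theorem empiricalNorm_add_le {d n : ℕ} (ω : Fin n → CSphere d) (A B : Matrix (Fin d) (Fin d) ℂ) :
    empiricalNorm ω (A + B) ≤ empiricalNorm ω A + empiricalNorm ω B := by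
  rw [empiricalNorm, empiricalNorm, empiricalNorm, ← add_div, ← Finset.sum_add_distrib]
  refine div_le_div_of_nonneg_right (Finset.sum_le_sum fun j _ => ?_) n.cast_nonneg
  rw [scaledExpect_add]
  exact abs_add_le _ _

theorem empiricalMean_add {d n : ℕ} (ω : Fin n → CSphere d) (A B : Matrix (Fin d) (Fin d) ℂ) :
    empiricalMean ω (A + B) = empiricalMean ω A + empiricalMean ω B := by
  simp only [empiricalMean, scaledExpect_add, Finset.sum_add_distrib, add_div]

theorem empiricalNorm_real_smul {d n : ℕ} (ω : Fin n → CSphere d) (r : ℝ)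
    (A : Matrix (Fin d) (Fin d) ℂ) : empiricalNorm ω (r • A) = |r| * empiricalNorm ω A := by
  simp only [empiricalNorm, scaledExpect_real_smul, abs_mul, ← Finset.mul_sum, mul_div_assoc]

theorem empiricalMean_real_smul {d n : ℕ} (ω : Fin n → CSphere d) (r : ℝ)
    (A : Matrix (Fin d) (Fin d) ℂ) : empiricalMean ω (r • A) = r * empiricalMean ω A := by
  simp only [empiricalMean, scaledExpect_real_smul, ← Finset.mul_sum, mul_div_assoc]

theorem abs_empiricalMean_le {d n : ℕ} (ω : Fin n → CSphere d) (A : Matrix (Fin d) (Fin d) ℂ) :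
    |empiricalMean ω A| ≤ empiricalNorm ω A := by
  rw [empiricalMean, empiricalNorm, abs_div, Nat.abs_cast]
  exact div_le_div_of_nonneg_right (Finset.abs_sum_le_sum_abs _ _) n.cast_nonneg

theorem empiricalNorm_le {d n : ℕ} [NeZero d] (ω : Fin n → CSphere d)
    {Δ : Matrix (Fin d) (Fin d) ℂ} (hΔ : Δ.IsHermitian) :
    empiricalNorm ω Δ ≤ 4 * d * uniformNorm Δ := by
  have h0 : 0 ≤ 4 * d * uniformNorm Δ :=
    mul_nonneg (by positivity) (uniformNorm_nonneg Δ)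
  refine div_le_of_le_mul₀ n.cast_nonneg h0 ?_
  refine (Finset.sum_le_sum fun j _ => abs_scaledExpect_le hΔ (ω j)).trans (le_of_eq ?_)
  simp
  ring

/-- Accuracy on a net of the ball of radius `1 / 2` implies accuracy everywhere. -/
theorem isApproximating_of_net {d n : ℕ} [NeZero d] {ω : Fin n → CSphere d} {δ ρ : ℝ}
    (hρδ : ρ ≤ δ) (hδ : δ ≤ 1 / 8) {s : Finset (Matrix (Fin d) (Fin d) ℂ)}
    (hs : ∀ c ∈ s, c.IsHermitian)
    (hcov : ∀ Δ : Matrix (Fin d) (Fin d) ℂ, Δ.IsHermitian → uniformNorm Δ ≤ 1 / 2 →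
      ∃ c ∈ s, uniformNorm (Δ - c) ≤ ρ)
    (hnorm : ∀ c ∈ s, |empiricalNorm ω c - uniformNorm c| ≤ δ)
    (hmean : ∀ c ∈ s, |empiricalMean ω c - c.trace.re| ≤ δ) :
    IsApproximating (8 * δ) ω := by
  -- Bootstrap: if `B` is the current bound on the ratio of empirical to uniform norm, then on the
  -- sphere of radius `1/2` a net point and its remainder give `(1/2 + 1/8) + 1/8 + B/8`.
  -- Homogeneity turns this into the new bound `3/2 + B/4`, whose fixed point is `2`.
  have hstep : ∀ k : ℕ, ∀ Δ : Matrix (Fin d) (Fin d) ℂ, Δ.IsHermitian →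
      empiricalNorm ω Δ ≤ (2 + 4 * d * (1 / 4) ^ k) * uniformNorm Δ := by
    intro k
    induction k with
    | zero =>
      intro Δ hΔ
      have := empiricalNorm_le ω hΔ
      have := uniformNorm_nonneg Δ
      rw [pow_zero]
      linarith
    | succ k ih =>
      refine le_mul_uniformNorm_of_homogeneous (empiricalNorm_real_smul ω) fun Δ hΔ h1 => ?_
      obtain ⟨c, hc, hcd⟩ := hcov Δ hΔ h1.le
      have e1 := empiricalNorm_add_le ω c (Δ - c)
      have e2 := uniformNorm_add_le Δ ((-1 : ℝ) • (Δ - c))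
      rw [show Δ + (-1 : ℝ) • (Δ - c) = c by simp, uniformNorm_real_smul, abs_neg, abs_one,
        one_mul] at e2
      rw [add_sub_cancel] at e1
      have e3 := (abs_le.1 (hnorm c hc)).2
      have e4 := ih (Δ - c) (hΔ.sub (hs c hc))
      have e5 := mul_le_mul_of_nonneg_left (hcd.trans (hρδ.trans hδ))
        (by positivity : (0 : ℝ) ≤ 2 + 4 * d * (1 / 4) ^ k)
      rw [pow_succ]
      linarith
  have htwo : ∀ Δ : Matrix (Fin d) (Fin d) ℂ, Δ.IsHermitian →
      empiricalNorm ω Δ ≤ 2 * uniformNorm Δ := by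
    intro Δ hΔ
    have hlim : Filter.Tendsto (fun k : ℕ => (2 + 4 * d * (1 / 4 : ℝ) ^ k) * uniformNorm Δ)
        Filter.atTop (nhds ((2 + 4 * d * 0) * uniformNorm Δ)) :=
      (((tendsto_pow_atTop_nhds_zero_of_lt_one (by norm_num) (by norm_num)).const_mul _).const_add
        _).mul_const _
    have := ge_of_tendsto' hlim fun k => hstep k Δ hΔ
    linarith
  intro Δ hΔ
  constructor
  · refine le_mul_uniformNorm_of_homogeneous
      (F := fun Δ => |empiricalNorm ω Δ - uniformNorm Δ|) (fun r A => ?_) (fun Δ hΔ h1 => ?_) Δ hΔ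
    · rw [empiricalNorm_real_smul, uniformNorm_real_smul, ← mul_sub, abs_mul, abs_abs]
    · obtain ⟨c, hc, hcd⟩ := hcov Δ hΔ h1.le
      have e0 : uniformNorm ((-1 : ℝ) • (Δ - c)) = uniformNorm (Δ - c) := by
        rw [uniformNorm_real_smul, abs_neg, abs_one, one_mul]
      have e0' : empiricalNorm ω ((-1 : ℝ) • (Δ - c)) = empiricalNorm ω (Δ - c) := by
        rw [empiricalNorm_real_smul, abs_neg, abs_one, one_mul]
      have e1 := empiricalNorm_add_le ω c (Δ - c)
      have e2 := uniformNorm_add_le c (Δ - c)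
      have e1' := empiricalNorm_add_le ω Δ ((-1 : ℝ) • (Δ - c))
      have e2' := uniformNorm_add_le Δ ((-1 : ℝ) • (Δ - c))
      rw [e0, show Δ + (-1 : ℝ) • (Δ - c) = c by simp] at e2'
      rw [e0', show Δ + (-1 : ℝ) • (Δ - c) = c by simp] at e1'
      rw [add_sub_cancel] at e1 e2
      have e3 := abs_le.1 (hnorm c hc)
      have e4 := htwo (Δ - c) (hΔ.sub (hs c hc))
      rw [abs_le]
      constructor <;> linarith [e3.1, e3.2]
  · refine le_mul_uniformNorm_of_homogeneous
      (F := fun Δ => |empiricalMean ω Δ - Δ.trace.re|) (fun r A => ?_) (fun Δ hΔ h1 => ?_) Δ hΔ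
    · rw [empiricalMean_real_smul, Matrix.trace_smul, Complex.smul_re, smul_eq_mul, ← mul_sub,
        abs_mul]
    · obtain ⟨c, hc, hcd⟩ := hcov Δ hΔ h1.le
      have e1 := empiricalMean_add ω c (Δ - c)
      have e2 : (c + (Δ - c)).trace.re = c.trace.re + (Δ - c).trace.re := by
        rw [Matrix.trace_add, Complex.add_re]
      rw [add_sub_cancel] at e1 e2
      have e3 := abs_le.1 (hmean c hc)
      have e4 := htwo (Δ - c) (hΔ.sub (hs c hc))
      have e5 := abs_le.1 (abs_empiricalMean_le ω (Δ - c))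
      have e6 := abs_le.1 (abs_re_trace_le_uniformNorm (Δ - c))
      rw [abs_le]
      constructor <;> linarith [e3.1, e3.2, e5.1, e5.2, e6.1, e6.2]

/-- Union bound over the net. The factor `4` counts two statistics, each with two tails. -/
theorem measure_not_isApproximating_le {d : ℕ} [NeZero d] {n : ℕ} (hn : 0 < n) {δ : ℝ}
    (hδ : δ ≤ 1 / 8) {l : ℕ} (hl : (1 / 2) ^ (l + 1) ≤ δ) :
    (Measure.pi fun _ : Fin n => uniformSphere d).real {ω | ¬ IsApproximating (8 * δ) ω}
      ≤ 4 * 5 ^ (2 * d ^ 2 * l) * Real.exp (-(n * δ ^ 2 / 8192)) := by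
  have hδ0 : 0 ≤ δ := le_trans (by positivity) hl
  have hn' : (0 : ℝ) < n := Nat.cast_pos.2 hn
  obtain ⟨s, hcard, hs, hcov⟩ := exists_uniformNorm_net d l
  set μ := Measure.pi fun _ : Fin n => uniformSphere d
  set bad : Matrix (Fin d) (Fin d) ℂ → Set (Fin n → CSphere d) := fun c =>
    {ω | n * δ ≤ |∑ j, |scaledExpect c (ω j)| - n * ∫ ψ, |scaledExpect c ψ| ∂(uniformSphere d)|} ∪
    {ω | n * δ ≤ |∑ j, scaledExpect c (ω j) - n * ∫ ψ, scaledExpect c ψ ∂(uniformSphere d)|}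
  have hbad : ∀ c ∈ s, μ.real (bad c) ≤ 4 * Real.exp (-(n * δ ^ 2 / 8192)) := by
    intro c hc
    have hcont := continuous_scaledExpect c
    have hexp : Integrable (fun ψ => Real.exp (1 / 8 * |scaledExpect c ψ|)) (uniformSphere d) :=
      Continuous.integrable_uniformSphere (by fun_prop)
    have h4 := integral_exp_abs_scaledExpect_le_four (hs c hc).1 (hs c hc).2
    have h1 := measure_pi_abs_sum_sub_ge_le (integrable_scaledExpect c) hexp h4 hδ0
      (by linarith) n
    have h2 := measure_pi_abs_sum_sub_ge_le (integrable_scaledExpect c).abs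
      (by simpa only [abs_abs] using hexp) (by simpa only [abs_abs] using h4) hδ0 (by linarith) n
    refine (measureReal_union_le _ _).trans ?_
    linarith
  have hsub : {ω : Fin n → CSphere d | ¬ IsApproximating (8 * δ) ω} ⊆ ⋃ c ∈ s, bad c := by
    intro ω hω
    by_contra hcon
    refine hω (isApproximating_of_net hl hδ (fun c hc => (hs c hc).1) hcov ?_ ?_)
    all_goals
      intro c hc
      have h1 : ω ∉ bad c := fun h => hcon (Set.mem_biUnion hc h)
      simp only [bad, Set.mem_union, Set.mem_ofPred_eq, not_or, not_le] at h1
    · have : empiricalNorm ω c - uniformNorm c = (∑ j, |scaledExpect c (ω j)|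
          - n * ∫ ψ, |scaledExpect c ψ| ∂(uniformSphere d)) / n := by
        rw [empiricalNorm, uniformNorm]
        field_simp
      rw [this, abs_div, Nat.abs_cast, div_le_iff₀ hn']
      linarith [h1.1]
    · have : empiricalMean ω c - c.trace.re = (∑ j, scaledExpect c (ω j)
          - n * ∫ ψ, scaledExpect c ψ ∂(uniformSphere d)) / n := by
        rw [empiricalMean, integral_scaledExpect]
        field_simp
      rw [this, abs_div, Nat.abs_cast, div_le_iff₀ hn']
      linarith [h1.2]
  refine (measureReal_mono hsub (measure_ne_top _ _)).trans ((measureReal_biUnion_finset_le _ _).trans ?_)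
  refine (Finset.sum_le_sum hbad).trans ?_
  rw [Finset.sum_const, nsmul_eq_mul]
  have hcard' : (s.card : ℝ) ≤ 5 ^ (2 * d ^ 2 * l) := by exact_mod_cast hcard
  have := mul_le_mul_of_nonneg_right hcard'
    (by positivity : 0 ≤ 4 * Real.exp (-(n * δ ^ 2 / 8192)))
  linarith

/-! ### From a good sample to the normalized discrete POVM -/

theorem cfc_mul_cfc_of_isHermitian {d : ℕ} (A : Matrix (Fin d) (Fin d) ℂ)
    (f g : ℝ → ℝ) : cfc f A * cfc g A = cfc (fun x => f x * g x) A :=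
  (cfc_mul f g A (Matrix.finite_real_spectrum.continuousOn f)
    (Matrix.finite_real_spectrum.continuousOn g)).symm

theorem isHermitian_cfc {d : ℕ} (A : Matrix (Fin d) (Fin d) ℂ) (f : ℝ → ℝ) :
    (cfc f A).IsHermitian :=
  (cfc_predicate f A : IsSelfAdjoint _)

theorem isHermitian_rankOne {d : ℕ} (x : EuclideanSpace ℂ (Fin d)) : (rankOne x).IsHermitian :=
  (Matrix.posSemidef_vecMulVec_self_star _).isHermitian

theorem trace_rankOne {d : ℕ} (ψ : CSphere d) : (rankOne ψ.1).trace = 1 := by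
  have h2 : ∑ a, ‖ψ.1 a‖ ^ 2 = 1 := by
    rw [← EuclideanSpace.norm_sq_eq, norm_eq_of_mem_sphere ψ, one_pow]
  have h3 : ((∑ a, ‖ψ.1 a‖ ^ 2 : ℝ) : ℂ) = 1 := by rw [h2, Complex.ofReal_one]
  rw [Matrix.trace, ← h3]
  push_cast
  refine Finset.sum_congr rfl fun a _ => ?_
  simp [rankOne, vecMulVec_apply, Complex.mul_conj, Complex.normSq_eq_norm_sq]

theorem empiricalMean_eq {d n : ℕ} (ω : Fin n → CSphere d) (Δ : Matrix (Fin d) (Fin d) ℂ) :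
    empiricalMean ω Δ = (Δ * ((d / n : ℝ) • ∑ j, rankOne (ω j).1)).trace.re := by
  rw [Matrix.mul_smul, Matrix.trace_smul, Complex.smul_re, smul_eq_mul, Finset.mul_sum,
    Matrix.trace_sum, Complex.re_sum, empiricalMean]
  simp only [scaledExpect, expect, ← Finset.mul_sum]
  ring

theorem inv_sqrt_sub_one_sq_le {y : ℝ} (hy : |y - 1| ≤ 1 / 2) :
    ((Real.sqrt y)⁻¹ - 1) ^ 2 ≤ 4 * (y - 1) ^ 2 := by
  have hy1 := (abs_le.1 hy).1
  have hy0 : 0 < y := by linarith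
  set u := Real.sqrt y with hu
  have hu0 : 0 < u := Real.sqrt_pos.2 hy0
  have hu2 : y = u ^ 2 := (Real.sq_sqrt hy0.le).symm
  have h1 : (u⁻¹ - 1) ^ 2 = (u - 1) ^ 2 / u ^ 2 := by
    field_simp
    ring
  rw [h1, div_le_iff₀ (by positivity), hu2]
  have h2 : 1 ≤ 4 * (u + 1) ^ 2 * u ^ 2 := by nlinarith [sq_nonneg u]
  nlinarith [mul_le_mul_of_nonneg_left h2 (sq_nonneg (u - 1))]

section Frobenius

open scoped Matrix.Norms.Frobenius

/-- The sum of the projections of an approximating sample is close to a multiple of `1`. -/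
theorem frobenius_norm_sub_one_le {d n : ℕ} [NeZero d] (hn : 0 < n) {ω : Fin n → CSphere d}
    {η : ℝ} (hη : 0 ≤ η) (hω : IsApproximating η ω) :
    ‖(d / n : ℝ) • ∑ j, rankOne (ω j).1 - 1‖ ≤ 12 * η := by
  have hn' : (n : ℝ) ≠ 0 := Nat.cast_ne_zero.2 hn.ne'
  set T : Matrix (Fin d) (Fin d) ℂ := (d / n : ℝ) • ∑ j, rankOne (ω j).1 with hT
  have hTh : T.IsHermitian := by
    refine Matrix.IsHermitian.smul ?_ (IsSelfAdjoint.all _)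
    exact isSelfAdjoint_sum _ fun j _ => isHermitian_rankOne _
  have hH : (T - 1).IsHermitian := hTh.sub Matrix.isHermitian_one
  have htr : (T - 1).trace = 0 := by
    rw [Matrix.trace_sub, hT, Matrix.trace_smul, Matrix.trace_sum,
      Finset.sum_congr rfl fun j _ => trace_rankOne (ω j), Matrix.trace_one]
    have hc : (n : ℂ) ≠ 0 := Nat.cast_ne_zero.2 hn.ne'
    simp
    field_simp
    simp
  -- The linear statistic is tested on `T - 1` itself, where its deviation is the squared Frobenius
  -- norm. As the trace vanishes, the uniform norm is at most `12 ‖T - 1‖`, and one power cancels.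
  have h1 := (hω _ hH).2
  have h2 : empiricalMean ω (T - 1) - (T - 1).trace.re = ‖T - 1‖ ^ 2 := by
    rw [empiricalMean_eq, ← hT, frobenius_norm_sq_eq_trace, hH.eq, ← Complex.sub_re,
      ← Matrix.trace_sub]
    congr 2
    noncomm_ring
  have h3 := uniformNorm_le hH
  rw [htr, norm_zero, add_zero] at h3
  rw [h2, abs_of_nonneg (sq_nonneg _)] at h1
  have h4 := mul_le_mul_of_nonneg_left h3 hη
  by_contra! hcon
  have h5 : 0 ≤ ‖T - 1‖ := norm_nonneg _
  nlinarith

/-- Conjugation by a matrix close to `1` changes the uniform norm only slightly. -/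
theorem uniformNorm_conj_sub_le {d : ℕ} [NeZero d] {R Δ : Matrix (Fin d) (Fin d) ℂ}
    (hR : R.IsHermitian) (hΔ : Δ.IsHermitian) {e : ℝ} (he : ‖R - 1‖ ≤ e) (he1 : e ≤ 1) :
    uniformNorm (R * Δ * R - Δ) ≤ 288 * e * uniformNorm Δ := by
  set E := R - 1 with hE
  have hD : R * Δ * R - Δ = E * Δ + Δ * E + E * Δ * E := by
    rw [show R = E + 1 by rw [hE]; abel]
    noncomm_ring
  have hDh : (R * Δ * R - Δ).IsHermitian := by
    refine Matrix.IsHermitian.sub ?_ hΔ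
    have := Matrix.isHermitian_conjTranspose_mul_mul R hΔ
    rwa [hR.eq] at this
  have hE0 := norm_nonneg E
  have hΔ0 := norm_nonneg Δ
  have he0 : 0 ≤ e := hE0.trans he
  have hED : ‖E * Δ‖ ≤ e * ‖Δ‖ :=
    (Matrix.frobenius_norm_mul _ _).trans (mul_le_mul_of_nonneg_right he hΔ0)
  have hnorm : ‖R * Δ * R - Δ‖ ≤ 3 * e * ‖Δ‖ := by
    rw [hD]
    have h1 : ‖Δ * E‖ ≤ ‖Δ‖ * e :=
      (Matrix.frobenius_norm_mul _ _).trans (mul_le_mul_of_nonneg_left he hΔ0)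
    have h2 : ‖E * Δ * E‖ ≤ e * ‖Δ‖ * 1 :=
      (Matrix.frobenius_norm_mul _ _).trans (mul_le_mul hED (he.trans he1) hE0 (by positivity))
    have h3 := norm_add_le (E * Δ + Δ * E) (E * Δ * E)
    have h4 := norm_add_le (E * Δ) (Δ * E)
    linarith
  have htrace : ‖(R * Δ * R - Δ).trace‖ ≤ 3 * e * ‖Δ‖ := by
    rw [hD, Matrix.trace_add, Matrix.trace_add]
    have h0 : ‖(E * Δ).trace‖ ≤ e * ‖Δ‖ :=
      (norm_trace_mul_le _ _).trans (mul_le_mul_of_nonneg_right he hΔ0)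
    have h1 : ‖(Δ * E).trace‖ ≤ ‖Δ‖ * e :=
      (norm_trace_mul_le _ _).trans (mul_le_mul_of_nonneg_left he hΔ0)
    have h2 : ‖(E * Δ * E).trace‖ ≤ e * ‖Δ‖ * 1 :=
      (norm_trace_mul_le _ _).trans (mul_le_mul hED (he.trans he1) hE0 (by positivity))
    have h3 := norm_add_le ((E * Δ).trace + (Δ * E).trace) (E * Δ * E).trace
    have h4 := norm_add_le (E * Δ).trace (Δ * E).trace
    linarith
  -- The constant is `288 = 12·(3 + 3)·4`: Frobenius norm and trace each contribute `3e‖Δ‖`, and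
  -- `‖Δ‖` is at most four times the uniform norm.
  have h1 := uniformNorm_le hDh
  have h2 := mul_le_mul_of_nonneg_left (frobenius_norm_le_uniformNorm hΔ) (hE0.trans he)
  linarith

/-- With `a = n/d` and `R = √a S^{-1/2}`, cyclicity of the trace makes the discrete norm of `Δ`
equal to the empirical norm of `RΔR`. Sampling replaces the latter by the uniform norm of `RΔR`, and
`R` is close to `1` because `S/a` is. -/
theorem normalizedFamily_spec {d n : ℕ} [NeZero d] (hn : 0 < n) {ω : Fin n → CSphere d}
    {ε : ℝ} (hε0 : 0 ≤ ε) (hε1 : ε ≤ 1) (hω : IsApproximating (ε / 7000) ω) :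
    IsDiscretePOVM (normalizedFamily ω) ∧
      ∀ Δ : Matrix (Fin d) (Fin d) ℂ, Δ.IsHermitian →
        |discreteDistNorm (normalizedFamily ω) Δ - uniformNorm Δ| ≤ ε * uniformNorm Δ := by
  have hn' : (0 : ℝ) < n := Nat.cast_pos.2 hn
  have hd' : (0 : ℝ) < d := Nat.cast_pos.2 (NeZero.pos d)
  set S : Matrix (Fin d) (Fin d) ℂ := ∑ j, rankOne (ω j).1 with hS
  have hSh : S.IsHermitian := isSelfAdjoint_sum _ fun j _ => isHermitian_rankOne _
  set a : ℝ := n / d with ha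
  have ha0 : 0 < a := by positivity
  have hcid : cfc (fun x : ℝ => x) S = S := cfc_id' ℝ S
  have hcone : cfc (fun _ : ℝ => (1 : ℝ)) S = 1 := cfc_const_one ℝ S
  have hT : (d / n : ℝ) • S - 1 = cfc (fun x : ℝ => x / a - 1) S := by
    have h1 : cfc (fun x : ℝ => a⁻¹ * x - 1) S = a⁻¹ • S - 1 := by
      rw [cfc_sub (fun x : ℝ => a⁻¹ * x) (fun _ => 1) S, hcone, cfc_const_mul a⁻¹ _ S, hcid]
    rw [show (d / n : ℝ) = a⁻¹ by rw [ha, inv_div], ← h1]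
    congr 1
    ext x
    rw [div_eq_inv_mul]
  have hTle : ‖cfc (fun x : ℝ => x / a - 1) S‖ ≤ 12 * (ε / 7000) := by
    rw [← hT]
    exact frobenius_norm_sub_one_le hn (by positivity) hω
  -- Each eigenvalue deviation is bounded by the Frobenius norm; this makes `S` invertible and keeps
  -- its spectrum where the inverse square root is Lipschitz.
  have hev : ∀ i, |hSh.eigenvalues i / a - 1| ≤ 1 / 2 := by
    intro i
    have h1 : (hSh.eigenvalues i / a - 1) ^ 2 ≤ (1 / 2) ^ 2 := by
      have h2 := Finset.single_le_sum (f := fun i => (hSh.eigenvalues i / a - 1) ^ 2)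
        (fun _ _ => sq_nonneg _) (Finset.mem_univ i)
      rw [← frobenius_norm_sq_cfc hSh fun x => x / a - 1] at h2
      refine h2.trans (pow_le_pow_left₀ (norm_nonneg _) (hTle.trans ?_) 2)
      linarith
    exact abs_le_of_sq_le_sq h1 (by norm_num)
  have hpos : ∀ x ∈ spectrum ℝ S, 0 < x := by
    intro x hx
    rw [hSh.spectrum_real_eq_range_eigenvalues] at hx
    obtain ⟨i, rfl⟩ := hx
    have h1 := (abs_le.1 (hev i)).1
    have h2 : 0 < hSh.eigenvalues i / a := by linarith
    exact (div_pos_iff_of_pos_right ha0).1 h2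
  set Q := invSqrt S with hQ
  have hQh : Q.IsHermitian := isHermitian_cfc _ _
  have hQSQ : Q * S * Q = 1 := by
    conv_lhs => rw [← hcid]
    rw [hQ, invSqrt, cfc_mul_cfc_of_isHermitian, cfc_mul_cfc_of_isHermitian, ← hcone]
    refine cfc_congr fun x hx => ?_
    have h0 := hpos x hx
    have h1 := Real.sq_sqrt h0.le
    have h2 := (Real.sqrt_pos.2 h0).ne'
    rw [mul_right_comm, ← mul_inv, ← sq, h1, inv_mul_cancel₀ h0.ne']
  set R := Real.sqrt a • Q with hR
  have hRh : R.IsHermitian := hQh.smul (IsSelfAdjoint.all _)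
  have hR1 : R - 1 = cfc (fun x : ℝ => (Real.sqrt (x / a))⁻¹ - 1) S := by
    rw [cfc_sub (fun x : ℝ => (Real.sqrt (x / a))⁻¹) (fun _ => 1) S
      (Matrix.finite_real_spectrum.continuousOn _), hcone, hR, hQ, invSqrt,
      ← cfc_const_mul (Real.sqrt a) _ S (Matrix.finite_real_spectrum.continuousOn _)]
    congr 1
    refine cfc_congr fun x hx => ?_
    rw [Real.sqrt_div (hpos x hx).le, inv_div, div_eq_mul_inv]
  have hRle : ‖R - 1‖ ≤ 24 * (ε / 7000) := by
    have h1 : ‖R - 1‖ ^ 2 ≤ (24 * (ε / 7000)) ^ 2 := by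
      rw [hR1, frobenius_norm_sq_cfc hSh]
      refine (Finset.sum_le_sum fun i _ => inv_sqrt_sub_one_sq_le (hev i)).trans ?_
      rw [← Finset.mul_sum, ← frobenius_norm_sq_cfc hSh fun x => x / a - 1]
      have := pow_le_pow_left₀ (norm_nonneg _) hTle 2
      linarith
    exact le_of_sq_le_sq h1 (by positivity)
  refine ⟨⟨fun j => ?_, ?_⟩, fun Δ hΔ => ?_⟩
  · have h1 : (rankOne (ω j).1).PosSemidef := Matrix.posSemidef_vecMulVec_self_star _
    have h2 := h1.conjTranspose_mul_mul_same Q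
    rwa [hQh.eq] at h2
  · rw [← hQSQ]
    simp only [normalizedFamily, ← hS, ← hQ]
    rw [← Finset.sum_mul, ← Finset.mul_sum, ← hS]
  · have hRΔ : (R * Δ * R).IsHermitian := by
      have := Matrix.isHermitian_conjTranspose_mul_mul R hΔ
      rwa [hRh.eq] at this
    have hQΔ : (Q * Δ * Q).IsHermitian := by
      have := Matrix.isHermitian_conjTranspose_mul_mul Q hΔ
      rwa [hQh.eq] at this
    have hRQ : R * Δ * R = a • (Q * Δ * Q) := by
      rw [hR, Matrix.smul_mul, Matrix.smul_mul, Matrix.mul_smul, smul_smul,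
        Real.mul_self_sqrt ha0.le]
    have hdisc : discreteDistNorm (normalizedFamily ω) Δ = empiricalNorm ω (R * Δ * R) := by
      rw [discreteDistNorm, empiricalNorm, hRQ, Finset.sum_div]
      refine Finset.sum_congr rfl fun j _ => ?_
      have h1 : (Δ * normalizedFamily ω j).trace = (Q * Δ * Q * rankOne (ω j).1).trace := by
        simp only [normalizedFamily, ← hS, ← hQ]
        rw [← Matrix.mul_assoc, ← Matrix.mul_assoc, Matrix.trace_mul_comm]
        simp only [Matrix.mul_assoc]
      rw [h1, trace_mul_rankOne_eq_expect hQΔ, Complex.norm_real, Real.norm_eq_abs,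
        scaledExpect_real_smul, scaledExpect, ← mul_assoc, show a * d = n by rw [ha]; field_simp,
        abs_mul, Nat.abs_cast]
      field_simp
    have h1 := uniformNorm_conj_sub_le hRh hΔ hRle (by linarith)
    have h2 := abs_le.1 (hω _ hRΔ).1
    have h3 := uniformNorm_add_le Δ (R * Δ * R - Δ)
    have h4 := uniformNorm_add_le (R * Δ * R) ((-1 : ℝ) • (R * Δ * R - Δ))
    rw [add_sub_cancel] at h3
    rw [uniformNorm_real_smul, abs_neg, abs_one, one_mul,
      show R * Δ * R + (-1 : ℝ) • (R * Δ * R - Δ) = Δ by simp] at h4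
    have hm0 := uniformNorm_nonneg Δ
    -- Conjugation costs `288·24 = 6912` and sampling at most `2`, in units of `ε/7000`; their sum
    -- stays below `7000`.
    have h5 : 288 * (24 * (ε / 7000)) * uniformNorm Δ ≤ 6912 / 7000 * (ε * uniformNorm Δ) :=
      le_of_eq (by ring)
    have h6 : ε * uniformNorm Δ ≤ uniformNorm Δ := mul_le_of_le_one_left hm0 hε1
    have h7 : ε / 7000 * uniformNorm (R * Δ * R) ≤ ε / 7000 * (2 * uniformNorm Δ) :=
      mul_le_mul_of_nonneg_left (by linarith) (by positivity)
    rw [hdisc, abs_le]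
    constructor <;> linarith [h2.1, h2.2]

end Frobenius

/-! ### Tensor products of comparable densities -/

theorem lintegral_pi_succ {k : ℕ} {X : Fin (k + 1) → Type*} [∀ i, MeasurableSpace (X i)]
    (μ : ∀ i, Measure (X i)) [∀ i, SigmaFinite (μ i)] {f : (∀ i, X i) → ENNReal}
    (hf : Measurable f) :
    ∫⁻ x, f x ∂(Measure.pi μ)
      = ∫⁻ x₀, ∫⁻ x, f (Fin.cons x₀ x) ∂(Measure.pi fun i => μ (Fin.succ i)) ∂(μ 0) := by
  have hm : Measurable fun p : X 0 × (∀ i : Fin k, X i.succ) => (Fin.cons p.1 p.2 : ∀ i, X i) := by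
    refine measurable_pi_lambda _ fun i => ?_
    refine Fin.cases ?_ (fun i => ?_) i
    · exact measurable_fst
    · exact (measurable_pi_apply i).comp measurable_snd
  have h : Measure.pi μ = ((μ 0).prod (Measure.pi fun i : Fin k => μ i.succ)).map
      fun p => (Fin.cons p.1 p.2 : ∀ i, X i) := by
    refine Measure.pi_eq fun s hs => ?_
    have hpre : (fun p : X 0 × (∀ i : Fin k, X i.succ) => (Fin.cons p.1 p.2 : ∀ i, X i)) ⁻¹'
        (Set.univ.pi s) = s 0 ×ˢ (Set.univ.pi fun i : Fin k => s i.succ) := by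
      ext p
      simp [Fin.forall_fin_succ]
    rw [Measure.map_apply hm (MeasurableSet.univ_pi hs), hpre, Measure.prod_prod, Measure.pi_pi,
      Fin.prod_univ_succ]
  rw [h, lintegral_map hf hm]
  exact lintegral_prod _ (hf.comp hm).aemeasurable

theorem sum_pi_succ {k : ℕ} {d : Fin (k + 1) → ℕ} {M : Type*} [AddCommMonoid M]
    (f : (∀ i, Fin (d i)) → M) :
    ∑ a, f a = ∑ a₀ : Fin (d 0), ∑ a : ∀ i : Fin k, Fin (d i.succ), f (Fin.cons a₀ a) := by
  rw [← Fintype.sum_prod_type']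
  exact (Fintype.sum_equiv (Fin.consEquiv fun i => Fin (d i)) _ _ fun _ => rfl).symm

/-- The contraction of the last factors of `Δ` against `B`. -/
def contractTail {k : ℕ} {d : Fin (k + 1) → ℕ}
    (Δ : Matrix (∀ i, Fin (d i)) (∀ i, Fin (d i)) ℂ)
    (B : Matrix (∀ i : Fin k, Fin (d i.succ)) (∀ i : Fin k, Fin (d i.succ)) ℂ) :
    Matrix (Fin (d 0)) (Fin (d 0)) ℂ :=
  Matrix.of fun a b => ∑ a', ∑ b', Δ (Fin.cons a a') (Fin.cons b b') * B b' a'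

/-- The contraction of the first factor of `Δ` against `A`. -/
def contractHead {k : ℕ} {d : Fin (k + 1) → ℕ}
    (Δ : Matrix (∀ i, Fin (d i)) (∀ i, Fin (d i)) ℂ) (A : Matrix (Fin (d 0)) (Fin (d 0)) ℂ) :
    Matrix (∀ i : Fin k, Fin (d i.succ)) (∀ i : Fin k, Fin (d i.succ)) ℂ :=
  Matrix.of fun a' b' => ∑ a, ∑ b, Δ (Fin.cons a a') (Fin.cons b b') * A b a

theorem tensorMatrix_cons {k : ℕ} {d : Fin (k + 1) → ℕ}
    (A : ∀ i, Matrix (Fin (d i)) (Fin (d i)) ℂ) (a₀ b₀ : Fin (d 0))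
    (a b : ∀ i : Fin k, Fin (d i.succ)) :
    tensorMatrix A (Fin.cons a₀ a) (Fin.cons b₀ b)
      = A 0 a₀ b₀ * tensorMatrix (fun i : Fin k => A i.succ) a b := by
  simp [tensorMatrix, Fin.prod_univ_succ]

theorem trace_mul_tensorMatrix_eq_sum {k : ℕ} {d : Fin (k + 1) → ℕ}
    (Δ : Matrix (∀ i, Fin (d i)) (∀ i, Fin (d i)) ℂ)
    (A : ∀ i, Matrix (Fin (d i)) (Fin (d i)) ℂ) :
    (Δ * tensorMatrix A).trace = ∑ a, ∑ a', ∑ b, ∑ b', Δ (Fin.cons a a') (Fin.cons b b') *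
      (A 0 b a * tensorMatrix (fun i : Fin k => A i.succ) b' a') := by
  simp only [Matrix.trace, Matrix.diag_apply, Matrix.mul_apply]
  rw [sum_pi_succ]
  refine Finset.sum_congr rfl fun a _ => Finset.sum_congr rfl fun a' _ => ?_
  rw [sum_pi_succ]
  simp only [tensorMatrix_cons]

theorem trace_mul_tensorMatrix_eq_contractTail {k : ℕ} {d : Fin (k + 1) → ℕ}
    (Δ : Matrix (∀ i, Fin (d i)) (∀ i, Fin (d i)) ℂ)
    (A : ∀ i, Matrix (Fin (d i)) (Fin (d i)) ℂ) :
    (Δ * tensorMatrix A).trace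
      = (contractTail Δ (tensorMatrix fun i : Fin k => A i.succ) * A 0).trace := by
  rw [trace_mul_tensorMatrix_eq_sum]
  simp only [Matrix.trace, Matrix.diag_apply, Matrix.mul_apply, contractTail, Matrix.of_apply,
    Finset.sum_mul]
  refine Finset.sum_congr rfl fun a _ => ?_
  rw [Finset.sum_comm]
  refine Finset.sum_congr rfl fun b _ => Finset.sum_congr rfl fun a' _ =>
    Finset.sum_congr rfl fun b' _ => ?_
  ring

theorem trace_mul_tensorMatrix_eq_contractHead {k : ℕ} {d : Fin (k + 1) → ℕ}
    (Δ : Matrix (∀ i, Fin (d i)) (∀ i, Fin (d i)) ℂ)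
    (A : ∀ i, Matrix (Fin (d i)) (Fin (d i)) ℂ) :
    (Δ * tensorMatrix A).trace
      = (contractHead Δ (A 0) * tensorMatrix fun i : Fin k => A i.succ).trace := by
  rw [trace_mul_tensorMatrix_eq_sum]
  simp only [Matrix.trace, Matrix.diag_apply, Matrix.mul_apply, contractHead, Matrix.of_apply,
    Finset.sum_mul]
  rw [Finset.sum_comm]
  refine Finset.sum_congr rfl fun a' _ => ?_
  refine ((Finset.sum_congr rfl fun a _ => Finset.sum_comm).trans Finset.sum_comm).trans ?_
  refine Finset.sum_congr rfl fun b' _ => ?_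
  refine Finset.sum_congr rfl fun a _ => Finset.sum_congr rfl fun b _ => ?_
  ring

theorem isHermitian_contractTail {k : ℕ} {d : Fin (k + 1) → ℕ}
    {Δ : Matrix (∀ i, Fin (d i)) (∀ i, Fin (d i)) ℂ} (hΔ : Δ.IsHermitian)
    {B : Matrix (∀ i : Fin k, Fin (d i.succ)) (∀ i : Fin k, Fin (d i.succ)) ℂ}
    (hB : B.IsHermitian) : (contractTail Δ B).IsHermitian := by
  ext a b
  simp only [contractTail, Matrix.conjTranspose_apply, Matrix.of_apply, star_sum, star_mul']
  rw [Finset.sum_comm]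
  refine Finset.sum_congr rfl fun a' _ => Finset.sum_congr rfl fun b' _ => ?_
  rw [hΔ.apply, hB.apply]

theorem isHermitian_contractHead {k : ℕ} {d : Fin (k + 1) → ℕ}
    {Δ : Matrix (∀ i, Fin (d i)) (∀ i, Fin (d i)) ℂ} (hΔ : Δ.IsHermitian)
    {A : Matrix (Fin (d 0)) (Fin (d 0)) ℂ}
    (hA : A.IsHermitian) : (contractHead Δ A).IsHermitian := by
  ext a b
  simp only [contractHead, Matrix.conjTranspose_apply, Matrix.of_apply, star_sum, star_mul']
  rw [Finset.sum_comm]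
  refine Finset.sum_congr rfl fun a' _ => Finset.sum_congr rfl fun b' _ => ?_
  rw [hΔ.apply, hA.apply]

theorem isHermitian_tensorMatrix {k : ℕ} {d : Fin k → ℕ}
    {A : ∀ i, Matrix (Fin (d i)) (Fin (d i)) ℂ} (hA : ∀ i, (A i).IsHermitian) :
    (tensorMatrix A).IsHermitian := by
  ext a b
  simp only [tensorMatrix, Matrix.conjTranspose_apply, Matrix.of_apply, star_prod]
  exact Finset.prod_congr rfl fun i _ => (hA i).apply _ _

theorem measurable_trace_mul_tensorMatrix {Ω : Type*} [MeasurableSpace Ω] {k : ℕ} {d : Fin k → ℕ}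
    (Δ : Matrix (∀ i, Fin (d i)) (∀ i, Fin (d i)) ℂ)
    {F : Ω → ∀ i, Matrix (Fin (d i)) (Fin (d i)) ℂ}
    (hF : ∀ i a b, Measurable fun x => F x i a b) :
    Measurable fun x => (Δ * tensorMatrix (F x)).trace := by
  simp only [Matrix.trace, Matrix.diag_apply, Matrix.mul_apply, tensorMatrix, Matrix.of_apply]
  refine Finset.measurable_sum _ fun a _ => Finset.measurable_sum _ fun b _ =>
    Measurable.const_mul (Finset.measurable_prod _ fun i _ => hF i _ _) _

/-- If the densities `F i` are dominated by the densities `G i` up to a factor `c`, in the sense of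
distinguishability norms, then their tensor products are so up to the factor `c ^ k`. -/
theorem lintegral_trace_tensorMatrix_le (c : ENNReal) (k : ℕ) :
    ∀ {d : Fin k → ℕ} {X Y : Fin k → Type} [∀ i, MeasurableSpace (X i)]
    [∀ i, MeasurableSpace (Y i)] (μ : ∀ i, Measure (X i)) (ν : ∀ i, Measure (Y i))
    [∀ i, SigmaFinite (μ i)] [∀ i, SigmaFinite (ν i)]
    {F : ∀ i, X i → Matrix (Fin (d i)) (Fin (d i)) ℂ}
    {G : ∀ i, Y i → Matrix (Fin (d i)) (Fin (d i)) ℂ},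
    (∀ i a b, Measurable fun x => F i x a b) → (∀ i a b, Measurable fun y => G i y a b) →
    (∀ i x, (F i x).IsHermitian) → (∀ i y, (G i y).IsHermitian) →
    (∀ i (Δ : Matrix (Fin (d i)) (Fin (d i)) ℂ), Δ.IsHermitian →
      ∫⁻ x, ‖(Δ * F i x).trace‖ₑ ∂(μ i) ≤ c * ∫⁻ y, ‖(Δ * G i y).trace‖ₑ ∂(ν i)) →
    ∀ Δ : Matrix (∀ i, Fin (d i)) (∀ i, Fin (d i)) ℂ, Δ.IsHermitian →
      ∫⁻ x, ‖(Δ * tensorMatrix fun i => F i (x i)).trace‖ₑ ∂(Measure.pi μ)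
        ≤ c ^ k * ∫⁻ y, ‖(Δ * tensorMatrix fun i => G i (y i)).trace‖ₑ ∂(Measure.pi ν) := by
  induction k with
  | zero =>
    intro d X Y _ _ μ ν _ _ F G hFm hGm hF hG h Δ hΔ
    simp only [pow_zero, one_mul]
    rw [Measure.pi_of_empty μ, Measure.pi_of_empty ν,
      lintegral_dirac' _ (measurable_trace_mul_tensorMatrix Δ fun i => i.elim0).enorm,
      lintegral_dirac' _ (measurable_trace_mul_tensorMatrix Δ fun i => i.elim0).enorm]
    have : (fun i => F i ((isEmptyElim : ∀ i, X i) i))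
      = fun i => G i ((isEmptyElim : ∀ i, Y i) i) := funext fun i => i.elim0
    rw [this]
  | succ k ih =>
    intro d X Y _ _ μ ν _ _ F G hFm hGm hF hG h Δ hΔ
    have hmF : Measurable fun x : ∀ i, X i => ‖(Δ * tensorMatrix fun i => F i (x i)).trace‖ₑ :=
      (measurable_trace_mul_tensorMatrix Δ fun i a b =>
        (hFm i a b).comp (measurable_pi_apply i)).enorm
    have hmG : Measurable fun y : ∀ i, Y i => ‖(Δ * tensorMatrix fun i => G i (y i)).trace‖ₑ :=
      (measurable_trace_mul_tensorMatrix Δ fun i a b =>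
        (hGm i a b).comp (measurable_pi_apply i)).enorm
    rw [lintegral_pi_succ μ hmF, lintegral_pi_succ ν hmG]
    -- The hybrid product: the first factor is already exchanged, the others are not.
    let mix (y₀ : Y 0) (x : ∀ i : Fin k, X i.succ) : ∀ i, Matrix (Fin (d i)) (Fin (d i)) ℂ :=
      Fin.cons (G 0 y₀) fun i : Fin k => F i.succ (x i)
    have hmix : Measurable fun p : Y 0 × (∀ i : Fin k, X i.succ) =>
        ‖(Δ * tensorMatrix (mix p.1 p.2)).trace‖ₑ := by
      refine (measurable_trace_mul_tensorMatrix Δ fun i => ?_).enorm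
      refine Fin.cases (fun a b => ?_) (fun i a b => ?_) i
      · exact (hGm 0 a b).comp measurable_fst
      · exact (hFm i.succ a b).comp ((measurable_pi_apply i).comp measurable_snd)
    have hcons : Measurable fun p : X 0 × (∀ i : Fin k, X i.succ) =>
        ‖(Δ * tensorMatrix fun i => F i ((Fin.cons p.1 p.2 : ∀ i, X i) i)).trace‖ₑ := by
      refine (measurable_trace_mul_tensorMatrix Δ fun i => ?_).enorm
      refine Fin.cases (fun a b => ?_) (fun i a b => ?_) i
      · exact (hFm 0 a b).comp measurable_fst
      · exact (hFm i.succ a b).comp ((measurable_pi_apply i).comp measurable_snd)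
    -- The first variable is made innermost, so that for each fixed tail the hypothesis applies to
    -- the contracted operator, which is Hermitian because the tail is.
    rw [lintegral_lintegral_swap hcons.aemeasurable]
    calc ∫⁻ x, ∫⁻ x₀, ‖(Δ * tensorMatrix fun i => F i ((Fin.cons x₀ x : ∀ i, X i) i)).trace‖ₑ
            ∂(μ 0) ∂(Measure.pi fun i : Fin k => μ i.succ)
        ≤ ∫⁻ x, c * ∫⁻ y₀, ‖(Δ * tensorMatrix (mix y₀ x)).trace‖ₑ
            ∂(ν 0) ∂(Measure.pi fun i : Fin k => μ i.succ) := by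
          refine lintegral_mono fun x => ?_
          have h1 := h 0 (contractTail Δ (tensorMatrix fun i : Fin k => F i.succ (x i)))
            (isHermitian_contractTail hΔ (isHermitian_tensorMatrix fun i => hF _ _))
          simp only [trace_mul_tensorMatrix_eq_contractTail]
          exact h1
      _ = c * ∫⁻ y₀, ∫⁻ x, ‖(Δ * tensorMatrix (mix y₀ x)).trace‖ₑ
            ∂(Measure.pi fun i : Fin k => μ i.succ) ∂(ν 0) := by
          rw [lintegral_const_mul _ hmix.lintegral_prod_left',
            ← lintegral_lintegral_swap hmix.aemeasurable]
      _ ≤ c * ∫⁻ y₀, c ^ k * ∫⁻ y,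
            ‖(Δ * tensorMatrix fun i => G i ((Fin.cons y₀ y : ∀ i, Y i) i)).trace‖ₑ
            ∂(Measure.pi fun i : Fin k => ν i.succ) ∂(ν 0) := by
          refine mul_le_mul_right (lintegral_mono fun y₀ => ?_) _
          have h1 := ih (fun i : Fin k => μ i.succ) (fun i : Fin k => ν i.succ)
            (F := fun i => F i.succ) (G := fun i => G i.succ) (fun i => hFm i.succ)
            (fun i => hGm i.succ) (fun i => hF i.succ) (fun i => hG i.succ) (fun i => h i.succ)
            (contractHead Δ (G 0 y₀)) (isHermitian_contractHead hΔ (hG _ _))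
          simp only [trace_mul_tensorMatrix_eq_contractHead]
          exact h1
      _ = _ := by
          rw [lintegral_const_mul, ← mul_assoc, pow_succ']
          refine Measurable.lintegral_prod_right' (f := fun p : Y 0 × (∀ i : Fin k, Y i.succ) =>
            ‖(Δ * tensorMatrix fun i => G i ((Fin.cons p.1 p.2 : ∀ i, Y i) i)).trace‖ₑ) ?_
          refine (measurable_trace_mul_tensorMatrix Δ fun i => ?_).enorm
          refine Fin.cases (fun a b => ?_) (fun i a b => ?_) i
          · exact (hGm 0 a b).comp measurable_fst
          · exact (hGm i.succ a b).comp ((measurable_pi_apply i).comp measurable_snd)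

/-! ### The distinguishability norm of a POVM with a density -/

/-- The supremum is attained on the set where the scalar density `(tr Δ F).re` is nonnegative, as in
a Hahn decomposition. -/
theorem POVM.distNorm_ofDensity {Ω : Type*} [MeasurableSpace Ω] {ι : Type*} [Fintype ι]
    [DecidableEq ι] (μ : Measure Ω) (F : Ω → Matrix ι ι ℂ)
    (hF : ∀ a b, Integrable (fun ω => F ω a b) μ) (hpos : ∀ ω, (F ω).PosSemidef)
    (hone : ∀ a b, ∫ ω, F ω a b ∂μ = (1 : Matrix ι ι ℂ) a b)
    (hm : ∀ a b, Measurable fun ω => F ω a b) (Δ : Matrix ι ι ℂ) :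
    (POVM.ofDensity μ F hF hpos hone).distNorm Δ = ∫ ω, |(Δ * F ω).trace.re| ∂μ := by
  set g : Ω → ℝ := fun ω => (Δ * F ω).trace.re with hg
  have hgc : Integrable (fun ω => (Δ * F ω).trace) μ := by
    simp only [Matrix.trace, Matrix.diag_apply, Matrix.mul_apply]
    exact integrable_finsetSum _ fun a _ => integrable_finsetSum _ fun b _ =>
      (hF b a).const_mul _
  have hgi : Integrable g μ := hgc.re
  have hgm : Measurable g := by
    refine Complex.measurable_re.comp ?_
    simp only [Matrix.trace, Matrix.diag_apply, Matrix.mul_apply]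
    exact Finset.measurable_sum _ fun a _ => Finset.measurable_sum _ fun b _ =>
      (hm b a).const_mul _
  have htr : ∀ A, MeasurableSet A → (Δ * densityVectorMeasure μ F hF A).trace.re
      = ∫ ω in A, g ω ∂μ := by
    intro A hA
    have h1 : (Δ * densityVectorMeasure μ F hF A).trace = ∫ ω in A, (Δ * F ω).trace ∂μ := by
      have hi : ∀ a b, Integrable (fun ω => Δ a b * F ω b a) (μ.restrict A) := fun a b =>
        (hF b a).restrict.const_mul _
      simp only [Matrix.trace, Matrix.diag_apply, Matrix.mul_apply]
      rw [integral_finsetSum _ fun a _ => integrable_finsetSum _ fun b _ => hi a b]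
      refine Finset.sum_congr rfl fun a _ => ?_
      rw [integral_finsetSum _ fun b _ => hi a b]
      refine Finset.sum_congr rfl fun b _ => ?_
      rw [integral_const_mul, densityVectorMeasure_apply μ F hF hA]
    rw [h1]
    exact (integral_re hgc.integrableOn).symm
  have hval : ∀ A : {A : Set Ω // MeasurableSet A},
      ((Δ * (POVM.ofDensity μ F hF hpos hone).toVectorMeasure A.1).trace
        - (Δ * (POVM.ofDensity μ F hF hpos hone).toVectorMeasure (A.1)ᶜ).trace).re
      = ∫ ω in A.1, g ω ∂μ - ∫ ω in (A.1)ᶜ, g ω ∂μ := by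
    intro A
    rw [Complex.sub_re]
    exact congrArg₂ _ (htr _ A.2) (htr _ A.2.compl)
  have hle : ∀ A : {A : Set Ω // MeasurableSet A},
      ∫ ω in A.1, g ω ∂μ - ∫ ω in (A.1)ᶜ, g ω ∂μ ≤ ∫ ω, |g ω| ∂μ := by
    intro A
    rw [← integral_add_compl A.2 hgi.abs]
    have h1 := (abs_le.1 (abs_integral_le_integral_abs (μ := μ.restrict A.1) (f := g))).2
    have h2 := (abs_le.1 (abs_integral_le_integral_abs (μ := μ.restrict (A.1)ᶜ) (f := g))).1
    linarith
  have heq : ∫ ω in {ω | 0 ≤ g ω}, g ω ∂μ - ∫ ω in {ω | 0 ≤ g ω}ᶜ, g ω ∂μ = ∫ ω, |g ω| ∂μ := by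
    have hA : MeasurableSet {ω | 0 ≤ g ω} := measurableSet_le measurable_const hgm
    rw [← integral_add_compl hA hgi.abs, sub_eq_add_neg, ← integral_neg]
    congr 1
    · exact setIntegral_congr_fun hA fun ω hω => (abs_of_nonneg hω).symm
    · refine setIntegral_congr_fun hA.compl fun ω hω => ?_
      exact (abs_of_neg (not_le.1 (show ¬ 0 ≤ g ω from hω))).symm
  rw [POVM.distNorm]
  simp only [hval]
  refine le_antisymm (ciSup_le hle) ?_
  rw [← heq]
  exact le_ciSup (f := fun A : {A : Set Ω // MeasurableSet A} =>
    ∫ ω in A.1, g ω ∂μ - ∫ ω in (A.1)ᶜ, g ω ∂μ) ⟨_, Set.forall_mem_range.2 hle⟩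
    ⟨{ω | 0 ≤ g ω}, measurableSet_le measurable_const hgm⟩

theorem measurable_smul_rankOne {d : ℕ} (a b : Fin d) :
    Measurable fun ψ : CSphere d => ((d : ℂ) • rankOne ψ.1) a b := by
  simp only [Matrix.smul_apply, rankOne, vecMulVec_apply, Pi.star_apply, smul_eq_mul]
  exact ((measurable_sphere_coord a).mul
    (continuous_star.measurable.comp (measurable_sphere_coord b))).const_mul _

theorem isHermitian_smul_rankOne {d : ℕ} (ψ : CSphere d) : ((d : ℂ) • rankOne ψ.1).IsHermitian :=
  (posSemidef_smul_rankOne ψ.1).isHermitian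

theorem trace_mul_im_eq_zero {ι : Type*} [Fintype ι] {A B : Matrix ι ι ℂ} (hA : A.IsHermitian)
    (hB : B.IsHermitian) : (A * B).trace.im = 0 := by
  rw [← Complex.conj_eq_iff_im, ← RCLike.star_def, ← Matrix.trace_conjTranspose,
    Matrix.conjTranspose_mul, hA.eq, hB.eq, Matrix.trace_mul_comm]

theorem enorm_trace_mul_eq {ι : Type*} [Fintype ι] {A B : Matrix ι ι ℂ} (hA : A.IsHermitian)
    (hB : B.IsHermitian) : ‖(A * B).trace‖ₑ = ENNReal.ofReal |(A * B).trace.re| := by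
  rw [← ofReal_norm, ← Complex.re_add_im (A * B).trace, trace_mul_im_eq_zero hA hB,
    Complex.ofReal_zero, zero_mul, add_zero, Complex.norm_real, Real.norm_eq_abs,
    Complex.ofReal_re]

theorem distNorm_localUniformPOVM {k : ℕ} {d : Fin k → ℕ}
    (Δ : Matrix (∀ i, Fin (d i)) (∀ i, Fin (d i)) ℂ) :
    (localUniformPOVM d).distNorm Δ
      = ∫ ψ, |(Δ * tensorMatrix fun i => (d i : ℂ) • rankOne (ψ i).1).trace.re|
        ∂(Measure.pi fun i => uniformSphere (d i)) := by
  refine POVM.distNorm_ofDensity _ _ _ _ _ (fun a b => ?_) Δ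
  simp only [tensorMatrix, Matrix.of_apply]
  exact Finset.measurable_prod _ fun i _ =>
    (measurable_smul_rankOne (a i) (b i)).comp (measurable_pi_apply i)

theorem ofReal_distNorm_localUniformPOVM {k : ℕ} {d : Fin k → ℕ}
    {Δ : Matrix (∀ i, Fin (d i)) (∀ i, Fin (d i)) ℂ} (hΔ : Δ.IsHermitian) :
    ENNReal.ofReal ((localUniformPOVM d).distNorm Δ)
      = ∫⁻ ψ, ‖(Δ * tensorMatrix fun i => (d i : ℂ) • rankOne (ψ i).1).trace‖ₑ
        ∂(Measure.pi fun i => uniformSphere (d i)) := by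
  have hint : Integrable (fun ψ : ∀ i, CSphere (d i) =>
      (Δ * tensorMatrix fun i => (d i : ℂ) • rankOne (ψ i).1).trace)
      (Measure.pi fun i => uniformSphere (d i)) := by
    simp only [Matrix.trace, Matrix.diag_apply, Matrix.mul_apply]
    refine integrable_finsetSum _ fun a _ => integrable_finsetSum _ fun b _ =>
      Integrable.const_mul ?_ _
    exact Integrable.fintype_prod_dep
      (f := fun i (ψ : CSphere (d i)) => ((d i : ℂ) • rankOne ψ.1) (b i) (a i))
      fun i => (integrable_rankOne (b i) (a i)).const_mul _
  have hre := hint.re.abs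
  simp only [RCLike.re_eq_complex_re] at hre
  rw [distNorm_localUniformPOVM, ofReal_integral_eq_lintegral_ofReal hre
    (Filter.Eventually.of_forall fun ψ => abs_nonneg _)]
  refine lintegral_congr fun ψ => ?_
  rw [enorm_trace_mul_eq hΔ (isHermitian_tensorMatrix fun i => isHermitian_smul_rankOne _)]

theorem distNorm_localUniformPOVM_nonneg {k : ℕ} {d : Fin k → ℕ}
    (Δ : Matrix (∀ i, Fin (d i)) (∀ i, Fin (d i)) ℂ) : 0 ≤ (localUniformPOVM d).distNorm Δ := by
  rw [distNorm_localUniformPOVM]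
  exact integral_nonneg fun _ => abs_nonneg _

theorem ofReal_uniformNorm {d : ℕ} {Δ : Matrix (Fin d) (Fin d) ℂ} (hΔ : Δ.IsHermitian) :
    ENNReal.ofReal (uniformNorm Δ)
      = ∫⁻ ψ : CSphere d, ‖(Δ * ((d : ℂ) • rankOne ψ.1)).trace‖ₑ ∂(uniformSphere d) := by
  rw [uniformNorm, ofReal_integral_eq_lintegral_ofReal (integrable_scaledExpect Δ).abs
    (Filter.Eventually.of_forall fun _ => abs_nonneg _)]
  refine lintegral_congr fun ψ => ?_
  rw [enorm_trace_mul_eq hΔ (isHermitian_smul_rankOne ψ), scaledExpect, expect, Matrix.mul_smul,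
    Matrix.trace_smul, smul_eq_mul, ← Complex.ofReal_natCast, Complex.re_ofReal_mul]

/-- Counting measures put discrete POVMs in the same form as densities on spheres, so one comparison
lemma serves for both inequalities. -/
theorem pi_count {k : ℕ} (n : Fin k → ℕ) :
    (Measure.pi fun i => (Measure.count : Measure (Fin (n i)))) = Measure.count := by
  refine Measure.ext_iff_singleton.2 fun a => ?_
  simp [Measure.pi_singleton]

theorem ofReal_discreteDistNorm {J ι : Type*} [Fintype J] [MeasurableSpace J]
    [MeasurableSingletonClass J] [Fintype ι] (M : J → Matrix ι ι ℂ) (Δ : Matrix ι ι ℂ) :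
    ENNReal.ofReal (discreteDistNorm M Δ) = ∫⁻ j, ‖(Δ * M j).trace‖ₑ ∂Measure.count := by
  rw [lintegral_count, tsum_fintype, discreteDistNorm,
    ENNReal.ofReal_sum_of_nonneg fun _ _ => norm_nonneg _]
  simp only [ofReal_norm]

/-- Comparisons of local POVMs with the uniform POVMs carry over to tensor products. -/
theorem discreteDistNorm_tensorFamily_bounds {k : ℕ} {d n : Fin k → ℕ} {ε : ℝ} (hε0 : 0 ≤ ε)
    (hε1 : ε < 1) {M : ∀ i, Fin (n i) → Matrix (Fin (d i)) (Fin (d i)) ℂ}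
    (hM : ∀ i j, (M i j).IsHermitian)
    (h : ∀ i (Δ : Matrix (Fin (d i)) (Fin (d i)) ℂ), Δ.IsHermitian →
      |discreteDistNorm (M i) Δ - uniformNorm Δ| ≤ ε * uniformNorm Δ)
    {Δ : Matrix (∀ i, Fin (d i)) (∀ i, Fin (d i)) ℂ} (hΔ : Δ.IsHermitian) :
    (1 - ε) ^ k * (localUniformPOVM d).distNorm Δ ≤ discreteDistNorm (tensorFamily M) Δ ∧
      discreteDistNorm (tensorFamily M) Δ ≤ (1 + ε) ^ k * (localUniformPOVM d).distNorm Δ := by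
  have hpos : 0 < 1 - ε := by linarith
  have hdisc : ENNReal.ofReal (discreteDistNorm (tensorFamily M) Δ)
      = ∫⁻ j, ‖(Δ * tensorMatrix fun i => M i (j i)).trace‖ₑ
        ∂(Measure.pi fun i => (Measure.count : Measure (Fin (n i)))) := by
    rw [pi_count, ofReal_discreteDistNorm]
    rfl
  have hd0 : 0 ≤ discreteDistNorm (tensorFamily M) Δ :=
    Finset.sum_nonneg fun _ _ => norm_nonneg _
  constructor
  · have h1 := lintegral_trace_tensorMatrix_le (ENNReal.ofReal (1 - ε)⁻¹) k
      (fun i => uniformSphere (d i)) (fun i => (Measure.count : Measure (Fin (n i))))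
      (F := fun i ψ => (d i : ℂ) • rankOne ψ.1) (G := M)
      (fun i a b => measurable_smul_rankOne a b) (fun i a b => measurable_of_finite _)
      (fun i ψ => isHermitian_smul_rankOne ψ) hM
      (fun i A hA => by
        rw [← ofReal_uniformNorm hA, ← ofReal_discreteDistNorm, ← ENNReal.ofReal_mul (by positivity)]
        refine ENNReal.ofReal_le_ofReal ?_
        rw [le_inv_mul_iff₀ hpos]
        linarith [(abs_le.1 (h i A hA)).1]) Δ hΔ
    rw [← hdisc, ← ofReal_distNorm_localUniformPOVM hΔ, ← ENNReal.ofReal_pow (by positivity),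
      ← ENNReal.ofReal_mul (by positivity), ENNReal.ofReal_le_ofReal_iff (by positivity), inv_pow,
      le_inv_mul_iff₀ (by positivity)] at h1
    exact h1
  · have h1 := lintegral_trace_tensorMatrix_le (ENNReal.ofReal (1 + ε)) k
      (fun i => (Measure.count : Measure (Fin (n i)))) (fun i => uniformSphere (d i))
      (F := M) (G := fun i ψ => (d i : ℂ) • rankOne ψ.1)
      (fun i a b => measurable_of_finite _) (fun i a b => measurable_smul_rankOne a b)
      hM (fun i ψ => isHermitian_smul_rankOne ψ)
      (fun i A hA => by
        rw [← ofReal_uniformNorm hA, ← ofReal_discreteDistNorm, ← ENNReal.ofReal_mul (by positivity)]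
        refine ENNReal.ofReal_le_ofReal ?_
        linarith [(abs_le.1 (h i A hA)).2]) Δ hΔ
    rw [← hdisc, ← ofReal_distNorm_localUniformPOVM hΔ, ← ENNReal.ofReal_pow (by positivity),
      ← ENNReal.ofReal_mul (by positivity), ENNReal.ofReal_le_ofReal_iff
      (mul_nonneg (by positivity) (distNorm_localUniformPOVM_nonneg Δ))] at h1
    exact h1

/-! ### Probability estimates -/

/-- Balance of exponents in units of `d²L`: the prefactor `4` costs at most `2`, the net at most
`72`, and concentration gains `76`. The remaining `exp (-2d²L)` is smaller than `exp (-d)`. -/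
theorem measure_not_isApproximating_lt {d n : ℕ} [NeZero d] {ε : ℝ} (hε0 : 0 < ε) (hε1 : ε < 1)
    (hn : (76 * (56000 ^ 2 * 8192)) * ε⁻¹ ^ 2 * max 1 |Real.log ε| * (d : ℝ) ^ 2 ≤ n) :
    0 < n ∧ (Measure.pi fun _ : Fin n => uniformSphere d).real
      {ω | ¬ IsApproximating (ε / 7000) ω} < Real.exp (-(1 * d)) := by
  have hd1 : (1 : ℝ) ≤ d := Nat.one_le_cast.2 (NeZero.pos d)
  set L := max 1 |Real.log ε| with hL
  have hL1 : 1 ≤ L := le_max_left _ _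
  have hL2 : |Real.log ε| ≤ L := le_max_right _ _
  have hn0 : 0 < n := by
    have : (0 : ℝ) < n := lt_of_lt_of_le (by positivity) hn
    exact_mod_cast this
  refine ⟨hn0, ?_⟩
  set δ := ε / 56000 with hδ
  have hδ0 : 0 < δ := by positivity
  -- The net depth is the first with resolution finer than `δ`; minimality makes `l` logarithmic in
  -- `1/δ`.
  obtain ⟨l, hl1, hl2⟩ := exists_nat_pow_near_of_lt_one hδ0 (by linarith)
    (by norm_num : (0 : ℝ) < 1 / 2) (by norm_num)
  have hmain := measure_not_isApproximating_le (d := d) hn0 (by linarith) hl1.le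
  rw [show 8 * δ = ε / 7000 by rw [hδ]; ring] at hmain
  refine hmain.trans_lt ?_
  have hlog2 := Real.log_two_gt_d9
  -- Here `l log 2 ≤ |log ε| + log 56000`, with `56000 ≤ 2^16` and `1 ≤ 2 log 2`, whence `16 + 2 =
  -- 18`.
  have hlL : (l : ℝ) ≤ 18 * L := by
    have h1 : Real.log δ ≤ l * Real.log (1 / 2) := by
      rw [← Real.log_pow]
      exact Real.log_le_log hδ0 hl2
    have h2 : Real.log 56000 ≤ 16 * Real.log 2 := by
      rw [show (16 : ℝ) * Real.log 2 = Real.log (2 ^ 16) by rw [Real.log_pow]; norm_num]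
      exact Real.log_le_log (by norm_num) (by norm_num)
    rw [hδ, Real.log_div hε0.ne' (by norm_num), one_div, Real.log_inv] at h1
    have h3 := neg_abs_le (Real.log ε)
    have h4 : (l : ℝ) * Real.log 2 ≤ 18 * L * Real.log 2 := by nlinarith
    exact le_of_mul_le_mul_right h4 (by linarith)
  have h5 : (5 : ℝ) ≤ Real.exp 2 := by
    have := Real.quadratic_le_exp_of_nonneg (x := 2) (by norm_num)
    linarith
  have hdL : (1 : ℝ) ≤ (d : ℝ) ^ 2 * L := by nlinarith
  have hpow : (5 : ℝ) ^ (2 * d ^ 2 * l) ≤ Real.exp (72 * (d ^ 2 * L)) := by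
    calc (5 : ℝ) ^ (2 * d ^ 2 * l) ≤ Real.exp 2 ^ (2 * d ^ 2 * l) := by gcongr
      _ = Real.exp (4 * d ^ 2 * l) := by
        rw [← Real.exp_nat_mul]
        congr 1
        push_cast
        ring
      _ ≤ _ := by
        refine Real.exp_le_exp.2 ?_
        nlinarith [mul_le_mul_of_nonneg_left hlL (sq_nonneg (d : ℝ))]
  have h4 : (4 : ℝ) ≤ Real.exp (2 * (d ^ 2 * L)) := by
    have : Real.exp 2 ≤ Real.exp (2 * (d ^ 2 * L)) := Real.exp_le_exp.2 (by linarith)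
    linarith
  have hexp : Real.exp (-(n * δ ^ 2 / 8192)) ≤ Real.exp (-(76 * (d ^ 2 * L))) := by
    refine Real.exp_le_exp.2 (neg_le_neg ?_)
    have h6 := mul_le_mul_of_nonneg_right hn (by positivity : 0 ≤ δ ^ 2 / 8192)
    refine le_trans (le_of_eq ?_) (h6.trans (le_of_eq (by ring)))
    rw [hδ]
    field_simp
  calc 4 * 5 ^ (2 * d ^ 2 * l) * Real.exp (-(n * δ ^ 2 / 8192))
      ≤ Real.exp (2 * (d ^ 2 * L)) * Real.exp (72 * (d ^ 2 * L))
        * Real.exp (-(76 * (d ^ 2 * L))) := by gcongr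
    _ = Real.exp (-(2 * (d ^ 2 * L))) := by
        rw [← Real.exp_add, ← Real.exp_add]
        congr 1
        ring
    _ < Real.exp (-(1 * d)) := by
        refine Real.exp_lt_exp.2 (neg_lt_neg ?_)
        nlinarith

/-- If the event `G i` concerning the `i`-th block of an independent array fails with probability at
most `q i`, then some `G i` fails with probability at most `1 - ∏ (1 - q i)`. -/
theorem measure_exists_block_fails_le {k : ℕ} {n : Fin k → ℕ} {X : Fin k → Type}
    [∀ i, MeasurableSpace (X i)] (μ : ∀ i, Measure (X i)) [∀ i, IsProbabilityMeasure (μ i)]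
    {Ω : Type*} [MeasurableSpace Ω] (P : Measure Ω) [IsProbabilityMeasure P]
    {ψ : ∀ i, Fin (n i) → Ω → X i} (hlaw : ∀ i j, HasLaw (ψ i j) (μ i) P)
    (hind : iIndepFun (fun (p : Σ i, Fin (n i)) => ψ p.1 p.2) P)
    (G : ∀ i, Set (Fin (n i) → X i)) :
    P.real {ω | ∃ i, (fun j => ψ i j ω) ∉ G i}
      ≤ 1 - ∏ i, (1 - (Measure.pi fun _ : Fin (n i) => μ i).real (G i)ᶜ) := by
  have hae : ∀ p : Σ i, Fin (n i), AEMeasurable (ψ p.1 p.2) P := fun p =>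
    (hlaw p.1 p.2).aemeasurable
  have hmap := (iIndepFun_iff_map_fun_eq_pi_map hae).1 hind
  simp only [(hlaw _ _).map_eq] at hmap
  -- Failure sets need not be measurable; measurable hulls have the same measure and allow
  -- complements of boxes.
  set N : ∀ i, Set (Fin (n i) → X i) := fun i =>
    toMeasurable (Measure.pi fun _ : Fin (n i) => μ i) (G i)ᶜ with hN
  have hNm : ∀ i, MeasurableSet (N i) := fun i => measurableSet_toMeasurable _ _
  have hbox : MeasurableSet (Set.univ.pi fun i => (N i)ᶜ) :=
    MeasurableSet.univ_pi fun i => (hNm i).compl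
  -- Independence makes the joint law a product over all pairs of indices. Currying regroups it into
  -- a product over blocks, where the measure of a box factorizes.
  have hcurry := Measure.infinitePi_map_piCurry (fun i (_ : Fin (n i)) => μ i)
  simp only [Measure.infinitePi_eq_pi] at hcurry
  set e := MeasurableEquiv.piCurry fun i (_ : Fin (n i)) => X i with he
  have haem : AEMeasurable (fun ω (p : Σ i, Fin (n i)) => ψ p.1 p.2 ω) P :=
    aemeasurable_pi_lambda _ hae
  have hsub : {ω | ∃ i, (fun j => ψ i j ω) ∉ G i}
      ⊆ (fun ω (p : Σ i, Fin (n i)) => ψ p.1 p.2 ω) ⁻¹'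
        (e ⁻¹' (Set.univ.pi fun i => (N i)ᶜ)ᶜ) := by
    rintro ω ⟨i, hi⟩ hmem
    exact hmem i (Set.mem_univ i) (subset_toMeasurable _ _ hi)
  have hle : P {ω | ∃ i, (fun j => ψ i j ω) ∉ G i}
      ≤ (Measure.pi fun i => Measure.pi fun _ : Fin (n i) => μ i)
        (Set.univ.pi fun i => (N i)ᶜ)ᶜ := by
    refine (measure_mono hsub).trans ((Measure.le_map_apply haem _).trans ?_)
    rw [hmap, ← hcurry, MeasurableEquiv.map_apply]
  have hreal := ENNReal.toReal_mono (measure_ne_top _ _) hle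
  refine hreal.trans (le_of_eq ?_)
  change (Measure.pi fun i => Measure.pi fun _ : Fin (n i) => μ i).real _ = _
  rw [probReal_compl_eq_one_sub hbox, measureReal_def, Measure.pi_pi, ENNReal.toReal_prod]
  congr 1
  refine Finset.prod_congr rfl fun i _ => ?_
  rw [← measureReal_def, probReal_compl_eq_one_sub (hNm i), measureReal_def,
    measure_toMeasurable, ← measureReal_def]

end

/-! ### Conclusion for the random local POVMs -/

theorem theorem5p3 :
    ∃ C : ℝ, 0 < C ∧ ∀ ε : ℝ, 0 < ε → ε < 1 → ∃ c : ℝ, 0 < c ∧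
      ∀ (k : ℕ) (d n : Fin k → ℕ), 1 ≤ k → (∀ i, 1 ≤ d i) →
        (∀ i, C * ε⁻¹ ^ 2 * max 1 |Real.log ε| * (d i : ℝ) ^ 2 ≤ n i) →
      ∀ {Ω : Type*} [MeasurableSpace Ω] (P : Measure Ω) [IsProbabilityMeasure P]
        (ψ : ∀ i, Fin (n i) → Ω → CSphere (d i)),
        (∀ i j, HasLaw (ψ i j) (uniformSphere (d i)) P) →
        iIndepFun (fun (p : Σ i, Fin (n i)) => ψ p.1 p.2) P →
        P.real {ω | ¬ ((∀ i, IsDiscretePOVM (normalizedFamily fun j => ψ i j ω)) ∧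
          ∀ Δ : Matrix (∀ i, Fin (d i)) (∀ i, Fin (d i)) ℂ, Δ.IsHermitian →
            (1 - ε) ^ k * (localUniformPOVM d).distNorm Δ
                ≤ discreteDistNorm (tensorFamily fun i => normalizedFamily fun j => ψ i j ω) Δ ∧
            discreteDistNorm (tensorFamily fun i => normalizedFamily fun j => ψ i j ω) Δ
                ≤ (1 + ε) ^ k * (localUniformPOVM d).distNorm Δ)}
          < 1 - ∏ i, (1 - Real.exp (-(c * d i))) := by
  -- The constant `C` absorbs the sampling accuracy `ε/56000` and the Bernstein constant; `c = 1`
  -- then serves for every `ε`.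
  refine ⟨76 * (56000 ^ 2 * 8192), by norm_num, fun ε hε0 hε1 => ⟨1, one_pos, ?_⟩⟩
  intro k d n hk hd hn Ω _ P _ ψ hlaw hind
  have hdz : ∀ i, NeZero (d i) := fun i => ⟨Nat.one_le_iff_ne_zero.1 (hd i)⟩
  have hone := fun i => measure_not_isApproximating_lt hε0 hε1 (hn i)
  have hblock := measure_exists_block_fails_le (fun i => uniformSphere (d i)) P hlaw hind
    fun i => {ω | IsApproximating (ε / 7000) ω}
  refine lt_of_le_of_lt ((measureReal_mono ?_ (measure_ne_top _ _)).trans hblock) ?_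
  · intro ω hω
    by_contra hcon
    have hgood : ∀ i, IsApproximating (ε / 7000) fun j => ψ i j ω := fun i =>
      not_not.1 fun h => hcon ⟨i, h⟩
    have hspec := fun i => normalizedFamily_spec (hone i).1 hε0.le hε1.le (hgood i)
    exact hω ⟨fun i => (hspec i).1, fun Δ hΔ =>
      discreteDistNorm_tensorFamily_bounds hε0.le hε1 (fun i j => ((hspec i).1.1 j).isHermitian)
        (fun i => (hspec i).2) hΔ⟩
  -- Strictness passes from the blocks to the product because all factors `1 - exp(-d i)` are
  -- positive and `k ≥ 1` gives at least one block.
  · refine sub_lt_sub_left (Finset.prod_lt_prod_of_nonempty (fun i _ => ?_) (fun i _ => ?_) ?_) _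
    · have : (0 : ℝ) < d i := Nat.cast_pos.2 (hd i)
      rw [sub_pos, Real.exp_lt_one_iff]
      linarith
    · exact sub_lt_sub_left (hone i).2 _
    · exact ⟨⟨0, hk⟩, Finset.mem_univ _⟩
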